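/- All digraphs are finite, without loops and without parallel arcs; paths and cycles are directed, a path has at least one vertex and a cycle at least two. A digraph $D$ is \emph{strong} if every vertex can be reached by a path from every other vertex, and \emph{semicomplete} if any two distinct vertices are joined by at least one arc. Let $T$ be a semicomplete digraph with vertices $u_1,\dots,u_t$, $t\ge 2$, and let $H_1,\dots,H_t$ be digraphs on $n_1,\dots,n_t\ge 1$ vertices. The \emph{semicomplete composition} $Q=T[H_1,\dots,H_t]$ is the digraph on the disjoint union of $V(H_1),\dots,V(H_t)$ that contains all arcs of each $H_i$, all arcs $xy$ with $x\in V(H_i)$, $y\in V(H_p)$ and $u_iu_p\in A(T)$, and no other arcs. Let $\overline{K}_{n}$ be the digraph with $n$ vertices and no arcs. A \emph{$k$-path-$j$-cycle factor} of a digraph $D$ consists of $k$ paths and $j$ cycles of $D$ that are pairwise vertex-disjoint and together cover $V(D)$; $k=0$ or $j=0$ is allowed. A \emph{$k$-cycle factor} is a $0$-path-$k$-cycle factor, and a \emph{cycle subdigraph} is a collection of pairwise vertex-disjoint cycles. The \emph{path covering number} $pc(D)$ is the least $k$ such that $D$ has a $k$-path-$0$-cycle factor. For $j\ge 0$ let $\eta_j(D)$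 be the least $p\geq 0$ such that $D$ has a $p$-path-$j$-cycle factor, with $\eta_j(D)=\infty$ if there is no such $p$. Let $m_i(Q)$ be the largest number of vertices of $\overline{K}_{n_i}$ that are covered by a cycle subdigraph of $T[\overline{K}_{n_1},\dots,\overline{K}_{n_t}]$, and let $I(Q)=\{\,i : m_i(Q)<pc(H_i)\,\}$. \textbf{Theorem.} Suppose that $Q=T[H_1,\dots,H_t]$ is a strong semicomplete composition that has a cycle factor. Then for each $i\in I(Q)$ the set $\{\,j : \eta_j(H_i)=m_i(Q)\,\}$ is non-empty, and the least number $k_{\min}(Q)$ of cycles in a cycle factor of $Q$ is $$k_{\min}(Q)=1+\sum_{i\in I(Q)}\min\{\,j : \eta_j(H_i)=m_i(Q)\,\}.$$ -/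

import Mathlib

namespace DigraphComp

universe u v

/-- A digraph without loops. -/
def Loopless {V : Type u} (D : Digraph V) : Prop :=
  ∀ x, ¬ D.Adj x x

/-- A digraph is strong if every vertex can be reached from every vertex. -/
def Strong {V : Type u} (D : Digraph V) : Prop :=
  ∀ x y, Relation.ReflTransGen D.Adj x y

/-- A digraph is semicomplete if there is at least one arc between any two distinct vertices. -/
def Semicomplete {V : Type u} (D : Digraph V) : Prop :=
  ∀ x y, x ≠ y → D.Adj x y ∨ D.Adj y x

/-- The composition `T[H_1, …, H_t]`, on the disjoint union of the vertex sets of the `H i`. -/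
def composition {ι : Type u} {V : ι → Type v} (T : Digraph ι) (H : ∀ i, Digraph (V i)) :
    Digraph (Σ i, V i) where
  Adj x y := T.Adj x.1 y.1 ∨
    ∃ (i : ι) (a b : V i), x = ⟨i, a⟩ ∧ y = ⟨i, b⟩ ∧ (H i).Adj a b

/-- The corresponding extension of `T`: each `V i` becomes an independent set. -/
def extension {ι : Type u} (V : ι → Type v) (T : Digraph ι) : Digraph (Σ i, V i) :=
  composition T (fun i => (⊥ : Digraph (V i)))

/-- The list `l` is the vertex sequence of a directed path (possibly with a single vertex). -/
def IsPath {V : Type u} (D : Digraph V) (l : List V) : Prop :=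
  l ≠ [] ∧ l.Nodup ∧ l.IsChain D.Adj

/-- The cyclic sequence `c` is the vertex sequence of a directed cycle (of length at least 2). -/
def IsCycle {V : Type u} (D : Digraph V) (c : Cycle V) : Prop :=
  c.Nontrivial ∧ c.Nodup ∧ c.Chain D.Adj

/-- A `k`-path-`t`-cycle subdigraph: `k` paths and `t` cycles, pairwise vertex-disjoint. -/
structure PathCycleSubdigraph {V : Type u} (D : Digraph V) (k t : ℕ) where
  path : Fin k → List V
  cycle : Fin t → Cycle V
  isPath : ∀ a, IsPath D (path a)
  isCycle : ∀ b, IsCycle D (cycle b)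
  disjoint : Pairwise fun p q : Fin k ⊕ Fin t =>
    Disjoint (Sum.elim (fun a => {x | x ∈ path a}) (fun b => {x | x ∈ cycle b}) p)
      (Sum.elim (fun a => {x | x ∈ path a}) (fun b => {x | x ∈ cycle b}) q)

/-- The set of vertices covered by a path-cycle subdigraph. -/
def PathCycleSubdigraph.verts {V : Type u} {D : Digraph V} {k t : ℕ}
    (S : PathCycleSubdigraph D k t) : Set V :=
  {x | (∃ a, x ∈ S.path a) ∨ ∃ b, x ∈ S.cycle b}

/-- `D` has a `k`-path-`t`-cycle factor, i.e. a spanning `k`-path-`t`-cycle subdigraph. -/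
def HasPathCycleFactor {V : Type u} (D : Digraph V) (k t : ℕ) : Prop :=
  ∃ S : PathCycleSubdigraph D k t, S.verts = Set.univ

/-- `D` has a `t`-cycle factor. -/
def HasCycleFactor {V : Type u} (D : Digraph V) (t : ℕ) : Prop :=
  HasPathCycleFactor D 0 t

/-- The path covering number: the least `k` such that `D` has a `k`-path factor. -/
noncomputable def pc {V : Type u} (D : Digraph V) : ℕ :=
  sInf {k | HasPathCycleFactor D k 0}

/-- A finite digraph has a path factor, so the minimum defining `pc` is attained. -/
theorem hasPathCycleFactor_pc {V : Type u} [Fintype V] (D : Digraph V) :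
    HasPathCycleFactor D (pc D) 0 := by
  refine Nat.sInf_mem (s := {k | HasPathCycleFactor D k 0}) ⟨Fintype.card V, ?_⟩
  let e := (Fintype.equivFin V).symm
  refine ⟨⟨fun a => [e a], Fin.elim0, fun a => by simp [IsPath], fun b => b.elim0, ?_⟩, ?_⟩
  · rintro (p | p) (q | q) h
    · simpa using fun h' => h (by rw [h'])
    · exact q.elim0
    · exact p.elim0
    · exact p.elim0
  · ext x
    simp only [PathCycleSubdigraph.verts, Set.mem_ofPred_eq, Set.mem_univ, iff_true]
    exact Or.inl ⟨e.symm x, by simp⟩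

/-- `η_j(D)`, the least `p` such that `D` has a `p`-path-`j`-cycle factor;
it is `⊤` when there is no such `p`. -/
noncomputable def eta {V : Type u} (D : Digraph V) (j : ℕ) : ℕ∞ :=
  ⨅ (p : ℕ) (_ : HasPathCycleFactor D p j), (p : ℕ∞)

/-- The possible numbers of vertices of the `i`-th independent set that are covered by a cycle
subdigraph of the extension of `T`. -/
def coverNumbers {ι : Type u} (V : ι → Type v) (T : Digraph ι) (i : ι) : Set ℕ :=
  {n | ∃ (t : ℕ) (S : PathCycleSubdigraph (extension V T) 0 t),
    (S.verts ∩ {x | x.1 = i}).ncard = n}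

/-- `m_i(Q)`, the largest number of vertices of the `i`-th independent set that are covered by a
cycle subdigraph of the extension of `T`. -/
noncomputable def maxCover {ι : Type u} (V : ι → Type v) (T : Digraph ι) (i : ι) : ℕ :=
  sSup (coverNumbers V T i)

/-- For finite digraphs the maximum defining `maxCover` exists. -/
theorem isGreatest_maxCover {ι : Type u} [Fintype ι] (V : ι → Type v) [∀ i, Fintype (V i)]
    (T : Digraph ι) (i : ι) : IsGreatest (coverNumbers V T i) (maxCover V T i) := by
  have hb : BddAbove (coverNumbers V T i) := by
    refine ⟨Nat.card (Σ i, V i), ?_⟩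
    rintro n ⟨t, S, rfl⟩
    exact Set.ncard_le_card _
  have hne : (coverNumbers V T i).Nonempty :=
    ⟨_, 0, ⟨Fin.elim0, Fin.elim0, fun a => a.elim0, fun b => b.elim0, by
      rintro (p | p) <;> exact p.elim0⟩, rfl⟩
  exact ⟨Nat.sSup_mem hne hb, fun n hn => le_csSup hb hn⟩

open Classical in
/-- `I(Q)`, the set of indices `i` with `m_i(Q) < pc(H_i)`. -/
noncomputable def deficient {ι : Type u} [Fintype ι] {V : ι → Type v} (T : Digraph ι)
    (H : ∀ i, Digraph (V i)) : Finset ι :=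
  Finset.univ.filter fun i => maxCover V T i < pc (H i)

end DigraphComp

/-!
Write `E` for the extension of `T` on the vertex set of the composition `Q`. The proof rests on the
fact that a single cycle of `E` covers `m_i` vertices of every class `i`
(`exists_cyclic_list_ncard_le`, `exists_cycle_count_eq_maxCover`).

Cycle subdigraphs of `E` are encoded as permutations that move each vertex along an arc or fix it.
First, some cycle subdigraph covers `m_i` vertices in all classes simultaneously
(`exists_isPartialArcPerm_ncard_le`). If a class `i` is not covered as well as possible, an
alternating closed walk passes through an uncovered vertex `v` of this class. A step of that walk
that would uncover a vertex outside the class `i` can be avoided by a shortcut, because `v` is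
adjacent to this vertex. Hence the covered set can be enlarged.

Second, the covered vertices induce a strong extension with a cycle factor, and such a digraph is
hamiltonian (`exists_isArcPerm_sameCycle`). Consider a cycle factor whose cycles cannot be merged.
Two cycles never meet the same class, since exchanging the heads of two arcs would merge them. The
absence of such exchanges makes the direction of the arcs between two cycles `C` and `C'` invariant
under moving forwards along `C` and backwards along `C'`. If a vertex has arcs in both directions
to another cycle, an exchange of four arcs merges the two cycles (`IsMergeMaximal.not_mixed`). So all
arcs between two cycles have the same direction, and if there were more than one cycle, strongness
of `T` would allow three cycles to be merged.

The rest compares cycle factors of `Q` with path-cycle factors of the digraphs `H i`. A cycle of `Q`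
lies in some `H i` or is cut at its arcs from `T` into paths of the `H i`; contracting these paths
gives a cycle of `E`. A cycle factor of `Q` thus consists of `c` cycles that leave the `H i` and of
`j_i` cycles in each `H i`, where `H i` has a `p_i`-path-`j_i`-cycle factor with `p_i ≤ m_i`
(`HasCycleFactor.exists_pathCycleFactors`). Conversely, the vertices of the single cycle of `E` may be
replaced by `m_i` paths of each `H i` (`hasCycleFactor_of_pathCycleFactors`).

A cycle can be opened into a path, so `η_j ≤ η_{j+1} + 1`, and the least `j` with `η_j ≤ m_i`
satisfies `η_j = m_i` when `η_0 = pc > m_i` (`exists_eta_eq`). This yields both bounds if `c ≥ 1`. If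
`c = 0`, each `H i` has a cycle factor; opening one of its cycles shows that every class contributes
at least one cycle more than required.
-/

namespace DigraphComp

universe u v

section Permutations

open Equiv.Perm

/-! ### Merging cycles of a permutation -/

/-- If each `t` lies on the same cycle of `τ` as `σ t`, then the cycles of `τ` are unions of cycles
of `σ`. -/
theorem sameCycle_of_forall_sameCycle {α : Type*} {σ τ : Equiv.Perm α}
    (h : ∀ t, τ.SameCycle t (σ t)) {s t : α} (hst : σ.SameCycle s t) : τ.SameCycle s t := by
  obtain ⟨n, rfl⟩ := hst
  induction n with
  | zero => exact SameCycle.refl _ _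
  | succ n ih =>
    rw [zpow_add_one, (Commute.self_zpow σ n).symm.eq, Equiv.Perm.mul_apply]
    exact ih.trans (h _)
  | pred n ih =>
    refine ih.trans ?_
    have := h ((σ ^ (-(n : ℤ) - 1)) s)
    rw [← Equiv.Perm.mul_apply, ← zpow_one_add, add_sub_cancel] at this
    exact this.symm

/-- A permutation `τ` that agrees with `σ` on the cycle of `w`, except possibly at `w` and at `c`,
follows the segment of that cycle from `σ w` to `c`. -/
theorem sameCycle_apply_of_agree {α : Type*} [Finite α] {σ τ : Equiv.Perm α} {w c : α}
    (hwc : σ.SameCycle w c)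
    (h : ∀ t, σ.SameCycle w t → t ≠ w → t ≠ c → τ t = σ t) : τ.SameCycle (σ w) c := by
  classical
  have hex : ∃ n : ℕ, (σ ^ n) (σ w) = c :=
    (sameCycle_apply_left.2 hwc).exists_nat_pow_eq
  have key : ∀ k, k ≤ Nat.find hex → τ.SameCycle (σ w) ((σ ^ k) (σ w)) := by
    intro k
    induction k with
    | zero => exact fun _ => SameCycle.refl _ _
    | succ k ih =>
      intro hk
      have hc : (σ ^ k) (σ w) ≠ c := Nat.find_min hex hk
      -- the walk does not return to `w` before it reaches `c`, since otherwise it could be shortened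
      have hw : (σ ^ k) (σ w) ≠ w := by
        intro hw
        refine Nat.find_min hex (m := Nat.find hex - (k + 1)) (by omega) ?_
        have h1 : (σ ^ (k + 1)) (σ w) = σ w := by
          rw [pow_succ', Equiv.Perm.mul_apply, hw]
        have h2 := Nat.find_spec hex
        rw [← Nat.sub_add_cancel hk, pow_add, Equiv.Perm.mul_apply, h1] at h2
        exact h2
      have hs : σ.SameCycle w ((σ ^ k) (σ w)) := by
        rw [sameCycle_pow_right, sameCycle_apply_right]
      have := h _ hs hw hc
      rw [pow_succ', Equiv.Perm.mul_apply, ← this, sameCycle_apply_right]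
      exact ih (by omega)
  have := key _ le_rfl
  rwa [Nat.find_spec hex] at this

/-- Along a cycle on which a predicate is not constant, it changes from false to true. -/
theorem SameCycle.exists_not_and_apply {α : Type*} [Finite α] {σ : Equiv.Perm α} {b c : α}
    (h : σ.SameCycle b c) (p : α → Prop) (hb : ¬ p b) (hc : p c) :
    ∃ t, σ.SameCycle b t ∧ ¬ p t ∧ p (σ t) := by
  by_contra! hne
  obtain ⟨n, rfl⟩ := h.exists_nat_pow_eq
  have : ∀ k : ℕ, ¬ p ((σ ^ k) b) := by
    intro k
    induction k with
    | zero => simpa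
    | succ k ih =>
      rw [pow_succ', Equiv.Perm.mul_apply]
      exact hne _ (by simp [SameCycle.refl]) ih
  exact this n hc

section Maximal

variable {ι α : Type*} {T : Digraph ι} {cl : α → ι} {σ : Equiv.Perm α}

/-- The permutation `σ` maps each point along an arc of the digraph obtained from `T` by
replacing each vertex `i` by the independent set `cl ⁻¹' {i}`. Its cycles thus form a cycle factor
of that digraph. -/
def IsArcPerm (T : Digraph ι) (cl : α → ι) (σ : Equiv.Perm α) : Prop :=
  ∀ v, T.Adj (cl v) (cl (σ v))

/-- The permutation `σ` encodes a cycle factor, and no other cycle factor arises from it by merging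
some of its cycles. -/
def IsMergeMaximal (T : Digraph ι) (cl : α → ι) (σ : Equiv.Perm α) : Prop :=
  IsArcPerm T cl σ ∧ ∀ τ, IsArcPerm T cl τ → (∀ s t, σ.SameCycle s t → τ.SameCycle s t) →
    ∀ s t, τ.SameCycle s t → σ.SameCycle s t

/-- Otherwise exchanging the heads of the arcs that leave `a` and `b` would merge their cycles. -/
theorem IsMergeMaximal.not_adj_and_adj [Finite α] (hσ : IsMergeMaximal T cl σ) {a b : α}
    (hab : ¬ σ.SameCycle a b) : ¬ (T.Adj (cl a) (cl (σ b)) ∧ T.Adj (cl b) (cl (σ a))) := by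
  classical
  rintro ⟨h1, h2⟩
  have hne : a ≠ b := by rintro rfl; exact hab (SameCycle.refl _ _)
  set τ := σ * Equiv.swap a b with hτ
  have ha : τ a = σ b := by simp [hτ]
  have hb : τ b = σ a := by simp [hτ]
  have ho : ∀ t, t ≠ a → t ≠ b → τ t = σ t := fun t h h' => by
    simp [hτ, Equiv.swap_apply_of_ne_of_ne h h']
  have ea : τ.SameCycle (σ a) a := sameCycle_apply_of_agree (SameCycle.refl _ _)
    fun t ht hta _ => ho t hta (by rintro rfl; exact hab ht)
  have eb : τ.SameCycle (σ b) b := sameCycle_apply_of_agree (SameCycle.refl _ _)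
    fun t ht htb _ => ho t (by rintro rfl; exact hab ht.symm) htb
  have hab' : τ.SameCycle a b := by
    refine SameCycle.trans ?_ eb
    rw [← ha, sameCycle_apply_right]
  refine hab (hσ.2 τ ?_ (fun s t => sameCycle_of_forall_sameCycle ?_) a b hab')
  · intro v
    by_cases hva : v = a
    · rw [hva, ha]; exact h1
    by_cases hvb : v = b
    · rw [hvb, hb]; exact h2
    rw [ho v hva hvb]; exact hσ.1 v
  · intro t
    by_cases hva : t = a
    · rw [hva]; exact ea.symm
    by_cases hvb : t = b
    · rw [hvb]; exact eb.symm
    rw [← ho t hva hvb, sameCycle_apply_right]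

theorem IsMergeMaximal.class_ne [Finite α] (hσ : IsMergeMaximal T cl σ) {a b : α}
    (hab : ¬ σ.SameCycle a b) : cl a ≠ cl b := fun h =>
  hσ.not_adj_and_adj hab ⟨h ▸ hσ.1 b, h ▸ hσ.1 a⟩

/-- Vertices on different cycles are in different classes, hence adjacent. If `a → b`, then the
swap that would join the two cycles is not available, so `σ a → σ⁻¹ b`. -/
theorem IsMergeMaximal.adj_apply_inv [Finite α] (hsemi : Semicomplete T)
    (hσ : IsMergeMaximal T cl σ) {a b : α} (hab : ¬ σ.SameCycle a b) (h : T.Adj (cl a) (cl b)) :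
    T.Adj (cl (σ a)) (cl (σ⁻¹ b)) := by
  have hab' : ¬ σ.SameCycle (σ a) (σ⁻¹ b) := by simpa using hab
  refine (hsemi _ _ (hσ.class_ne hab')).resolve_right fun h' => ?_
  exact hσ.not_adj_and_adj (a := a) (b := σ⁻¹ b) (by simpa using hab) ⟨by simpa using h, h'⟩

theorem IsMergeMaximal.adj_inv_apply [Finite α] (hsemi : Semicomplete T)
    (hσ : IsMergeMaximal T cl σ) {a b : α} (hab : ¬ σ.SameCycle a b) (h : T.Adj (cl a) (cl b)) :
    T.Adj (cl (σ⁻¹ a)) (cl (σ b)) := by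
  have key : ∀ n : ℕ, T.Adj (cl ((σ ^ n) a)) (cl ((σ ^ n)⁻¹ b)) := by
    intro n
    induction n with
    | zero => simpa
    | succ n ih =>
      have := hσ.adj_apply_inv hsemi (a := (σ ^ n) a) (b := (σ ^ n)⁻¹ b)
        (by simpa [← zpow_natCast, ← zpow_neg] using hab) ih
      rwa [← Equiv.Perm.mul_apply, ← Equiv.Perm.mul_apply, ← pow_succ', ← mul_inv_rev,
        ← pow_succ] at this
  -- as `σ` has finite order, `σ⁻¹` is a natural power of `σ`
  have h1 : σ ^ (orderOf σ - 1) = σ⁻¹ := by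
    rw [eq_inv_iff_mul_eq_one, ← pow_succ, Nat.sub_add_cancel (orderOf_pos σ), pow_orderOf_eq_one]
  simpa [h1] using key (orderOf σ - 1)

theorem IsMergeMaximal.not_adj_symm [Finite α] (hsemi : Semicomplete T)
    (hσ : IsMergeMaximal T cl σ) {a b : α} (hab : ¬ σ.SameCycle a b) (h : T.Adj (cl a) (cl b)) :
    ¬ T.Adj (cl b) (cl a) := fun h' =>
  hσ.not_adj_and_adj (a := σ⁻¹ a) (b := b) (by simpa using hab)
    ⟨hσ.adj_inv_apply hsemi hab h, by simpa using h'⟩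

/-- A vertex `a` is not both in-adjacent and out-adjacent to another cycle. Otherwise some `w` on
that cycle has `w → a → σ w`, and some `z` on it has `σ⁻¹ a → σ z` and `z → σ a`; inserting `a`
between `w` and `σ w`, and the rest of the cycle of `a` between `z` and `σ z`, merges the two
cycles. -/
theorem IsMergeMaximal.not_mixed [Finite α] (hT : Loopless T) (hsemi : Semicomplete T)
    (hσ : IsMergeMaximal T cl σ) {a b c : α} (hab : ¬ σ.SameCycle a b) (hbc : σ.SameCycle b c)
    (h1 : T.Adj (cl a) (cl b)) (h2 : T.Adj (cl c) (cl a)) : False := by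
  classical
  have hac : ¬ σ.SameCycle a c := fun h => hab (h.trans hbc.symm)
  obtain ⟨w, hw, hw1, hw2⟩ := SameCycle.exists_not_and_apply hbc.symm
    (fun t => T.Adj (cl a) (cl t)) (fun h => hσ.not_adj_symm hsemi hac h h2) h1
  have haw : ¬ σ.SameCycle a w := fun h => hac (h.trans hw.symm)
  have hwa : T.Adj (cl w) (cl a) := (hsemi _ _ (hσ.class_ne haw)).resolve_left hw1
  -- the row of `σ a` changes in the other direction
  have h3 : T.Adj (cl (σ a)) (cl w) := by
    simpa using hσ.adj_apply_inv hsemi (a := a) (b := σ w) (by simpa using haw) hw2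
  have h4 : ¬ T.Adj (cl (σ a)) (cl (σ⁻¹ w)) := by
    intro h
    exact hw1 (by simpa using hσ.adj_inv_apply hsemi (by simpa using haw) h)
  obtain ⟨y, hy, hy1, hy2⟩ := SameCycle.exists_not_and_apply (σ := σ) (b := w) (c := σ⁻¹ w)
    (by simp [SameCycle.refl]) (fun t => ¬ T.Adj (cl (σ a)) (cl t)) (by simpa using h3) h4
  rw [not_not] at hy1
  have hay : ¬ σ.SameCycle a y := fun h => haw (h.trans hy.symm)
  set z := σ y with hz
  set u := σ⁻¹ a with hu
  have hwz : σ.SameCycle w z := by rw [hz, sameCycle_apply_right]; exact hy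
  have haz : ¬ σ.SameCycle a z := fun h => haw (h.trans hwz.symm)
  have hau : σ.SameCycle a u := by simp [hu, SameCycle.refl]
  have e1 : T.Adj (cl z) (cl (σ a)) :=
    (hsemi _ _ (hσ.class_ne (a := σ a) (b := z) (by simpa using haz))).resolve_left hy2
  have e2 : T.Adj (cl u) (cl (σ z)) := by
    have := hσ.adj_inv_apply hsemi (a := σ a) (b := y) (by simpa using hay) hy1
    exact hσ.adj_inv_apply hsemi (a := a) (b := z) haz (by simpa using this)
  have e3 : T.Adj (cl w) (cl (σ u)) := by simpa [hu] using hwa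
  have nau : a ≠ u := by
    intro h
    have := hσ.1 u
    rw [show σ u = a by simp [hu], ← h] at this
    exact hT _ this
  have nwz : w ≠ z := fun h => hy2 (h ▸ h3)
  have naw : a ≠ w := by rintro rfl; exact haw (SameCycle.refl _ _)
  have naz : a ≠ z := fun h => haz (h ▸ SameCycle.refl _ _)
  have nuw : u ≠ w := by intro h; exact haw (h ▸ hau)
  have nuz : u ≠ z := by intro h; exact haz (h ▸ hau)
  -- `τ` exchanges the heads of the four arcs that leave `a`, `w`, `u` and `z`
  set τ := σ * (Equiv.swap a w * Equiv.swap w u * Equiv.swap u z) with hτ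
  have ta : τ a = σ w := by
    rw [hτ, Equiv.Perm.mul_apply, Equiv.Perm.mul_apply, Equiv.Perm.mul_apply,
      Equiv.swap_apply_of_ne_of_ne nau naz, Equiv.swap_apply_of_ne_of_ne naw nau,
      Equiv.swap_apply_left]
  have tw : τ w = σ u := by
    simp [hτ, Equiv.swap_apply_of_ne_of_ne nuw.symm nwz, Equiv.swap_apply_of_ne_of_ne nau.symm nuw]
  have tu : τ u = σ z := by
    simp [hτ, Equiv.swap_apply_of_ne_of_ne nwz.symm nuz.symm,
      Equiv.swap_apply_of_ne_of_ne naz.symm nwz.symm]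
  have tz : τ z = σ a := by
    simp [hτ]
  have agree : ∀ t, t ≠ a → t ≠ w → t ≠ u → t ≠ z → τ t = σ t := fun t g1 g2 g3 g4 => by
    rw [hτ, Equiv.Perm.mul_apply, Equiv.Perm.mul_apply, Equiv.Perm.mul_apply,
      Equiv.swap_apply_of_ne_of_ne g3 g4, Equiv.swap_apply_of_ne_of_ne g2 g3,
      Equiv.swap_apply_of_ne_of_ne g1 g2]
  have s1 : τ.SameCycle (σ w) z := sameCycle_apply_of_agree hwz fun t ht htw htz =>
    agree t (by rintro rfl; exact haw ht.symm) htw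
      (by rintro rfl; exact haw (hau.trans ht.symm)) htz
  have s2 : τ.SameCycle (σ a) u := sameCycle_apply_of_agree hau fun t ht hta htu =>
    agree t hta (by rintro rfl; exact haw ht) htu (by rintro rfl; exact haz ht)
  have s3 : τ.SameCycle (σ z) w := sameCycle_apply_of_agree hwz.symm fun t ht htz htw =>
    agree t (by rintro rfl; exact haz ht.symm) htw
      (by rintro rfl; exact haz (hau.trans ht.symm)) htz
  have s4 : τ.SameCycle (σ u) a := by simp [hu, SameCycle.refl]
  have q1 : τ.SameCycle a (σ w) := by rw [← ta, sameCycle_apply_right]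
  have q2 : τ.SameCycle z (σ a) := by rw [← tz, sameCycle_apply_right]
  have q3 : τ.SameCycle u (σ z) := by rw [← tu, sameCycle_apply_right]
  have q4 : τ.SameCycle w (σ u) := by rw [← tw, sameCycle_apply_right]
  have r1 : τ.SameCycle a z := q1.trans s1
  have r2 : τ.SameCycle a u := r1.trans (q2.trans s2)
  have r3 : τ.SameCycle a w := r2.trans (q3.trans s3)
  refine haw (hσ.2 τ ?_ (fun s t => sameCycle_of_forall_sameCycle ?_) a w r3)
  · intro v
    by_cases va : v = a
    · rw [va, ta]; exact hw2
    by_cases vw : v = w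
    · rw [vw, tw]; exact e3
    by_cases vu : v = u
    · rw [vu, tu]; exact e2
    by_cases vz : v = z
    · rw [vz, tz]; exact e1
    rw [agree v va vw vu vz]; exact hσ.1 v
  · intro t
    by_cases va : t = a
    · rw [va]; exact r1.trans q2
    by_cases vw : t = w
    · rw [vw]; exact r3.symm.trans q1
    by_cases vu : t = u
    · rw [vu]; exact r2.symm.trans s4.symm
    by_cases vz : t = z
    · rw [vz]; exact r1.symm.trans (r2.trans q3)
    rw [← agree t va vw vu vz, sameCycle_apply_right]

/-- All arcs between two cycles have the same direction. -/
theorem IsMergeMaximal.adj_of_sameCycle [Finite α] (hT : Loopless T) (hsemi : Semicomplete T)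
    (hσ : IsMergeMaximal T cl σ) {a b a' b' : α} (hab : ¬ σ.SameCycle a b)
    (ha : σ.SameCycle a a') (hb : σ.SameCycle b b') (h : T.Adj (cl a) (cl b)) :
    T.Adj (cl a') (cl b') := by
  have h1 : ¬ σ.SameCycle a b' := fun h => hab (h.trans hb.symm)
  have h2 : ¬ σ.SameCycle a' b' := fun h => h1 (ha.trans h)
  have h3 : T.Adj (cl a) (cl b') := (hsemi _ _ (hσ.class_ne h1)).resolve_right fun h' =>
    hσ.not_mixed hT hsemi hab hb h h'
  exact (hsemi _ _ (hσ.class_ne h2)).resolve_right fun h' =>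
    hσ.not_mixed hT hsemi (fun h => h2 h.symm) ha.symm h' h3

/-- If `T` is strong, there is only one cycle. Otherwise, as all arcs between two cycles have the
same direction, strongness yields, for a cycle `C`, a cycle `A` dominated by `C` and a cycle `B`
dominating `C` such that there is an arc from `A` to `B`. The cycles `C`, `A` and `B` can then be
merged by exchanging one arc of each. -/
theorem IsMergeMaximal.sameCycle [Finite α] (hT : Loopless T) (hsemi : Semicomplete T)
    (hstrong : Strong T) (hσ : IsMergeMaximal T cl σ) (hcl : Function.Surjective cl) (x y : α) :
    σ.SameCycle x y := by
  classical
  by_contra hxy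
  obtain ⟨a, hxa, hxa'⟩ : ∃ a, ¬ σ.SameCycle x a ∧ T.Adj (cl x) (cl a) := by
    by_contra! hno
    have : ∀ i, Relation.ReflTransGen T.Adj (cl x) i → ∀ b, cl b = i → σ.SameCycle x b := by
      intro i hi
      induction hi with
      | refl =>
        intro b hb
        by_contra h
        exact hσ.class_ne h hb.symm
      | @tail i j _ hij ih =>
        rintro b rfl
        obtain ⟨d, rfl⟩ := hcl i
        by_contra h
        have hxd := ih d rfl
        exact hno b h (hσ.adj_of_sameCycle hT hsemi (fun h' => h (hxd.trans h')) hxd.symm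
          (SameCycle.refl _ _) hij)
    exact hxy (this _ (hstrong _ _) y rfl)
  obtain ⟨b, s, hxb, hxb', hxs, hxs', hbs⟩ : ∃ b s, ¬ σ.SameCycle x b ∧ T.Adj (cl x) (cl b) ∧
      ¬ σ.SameCycle x s ∧ ¬ T.Adj (cl x) (cl s) ∧ T.Adj (cl b) (cl s) := by
    by_contra! hno
    have : ∀ i, Relation.ReflTransGen T.Adj (cl a) i → ∀ b, cl b = i →
        ¬ σ.SameCycle x b ∧ T.Adj (cl x) (cl b) := by
      intro i hi
      induction hi with
      | refl =>
        intro b hb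
        rw [hb]
        refine ⟨fun h => hσ.class_ne (fun h' => hxa (h.trans h')) hb, hxa'⟩
      | @tail i j _ hij ih =>
        rintro b rfl
        obtain ⟨d, rfl⟩ := hcl i
        obtain ⟨h1, h2⟩ := ih d rfl
        have hb : ¬ σ.SameCycle x b := fun h =>
          hσ.not_adj_symm hsemi (fun h' => h1 (h.trans h'))
            (hσ.adj_of_sameCycle hT hsemi h1 h (SameCycle.refl _ _) h2) hij
        exact ⟨hb, by_contra fun h => hno d b h1 h2 hb h hij⟩
    exact (this _ (hstrong _ _) x rfl).1 (SameCycle.refl _ _)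
  have hsx : T.Adj (cl s) (cl x) := (hsemi _ _ (hσ.class_ne hxs)).resolve_left hxs'
  have hnbs : ¬ σ.SameCycle b s := fun h =>
    hxs' (hσ.adj_of_sameCycle hT hsemi hxb (SameCycle.refl _ _) h hxb')
  obtain ⟨c, rfl⟩ := σ.surjective s
  have hxc : ¬ σ.SameCycle x c := by simpa using hxs
  have hbc : ¬ σ.SameCycle b c := by simpa using hnbs
  have nxb : x ≠ b := by rintro rfl; exact hxb (SameCycle.refl _ _)
  have nxc : x ≠ c := by rintro rfl; exact hxc (SameCycle.refl _ _)
  have nbc : b ≠ c := by rintro rfl; exact hbc (SameCycle.refl _ _)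
  set τ := σ * (Equiv.swap x b * Equiv.swap b c) with hτ
  have tx : τ x = σ b := by simp [hτ, Equiv.swap_apply_of_ne_of_ne nxb nxc]
  have tb : τ b = σ c := by simp [hτ, Equiv.swap_apply_of_ne_of_ne nxc.symm nbc.symm]
  have tc : τ c = σ x := by simp [hτ]
  have agree : ∀ t, t ≠ x → t ≠ b → t ≠ c → τ t = σ t := fun t g1 g2 g3 => by
    rw [hτ, Equiv.Perm.mul_apply, Equiv.Perm.mul_apply, Equiv.swap_apply_of_ne_of_ne g2 g3,
      Equiv.swap_apply_of_ne_of_ne g1 g2]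
  have sx : τ.SameCycle (σ x) x := sameCycle_apply_of_agree (SameCycle.refl _ _)
    fun t ht htx _ => agree t htx (by rintro rfl; exact hxb ht) (by rintro rfl; exact hxc ht)
  have sb : τ.SameCycle (σ b) b := sameCycle_apply_of_agree (SameCycle.refl _ _)
    fun t ht htb _ => agree t (by rintro rfl; exact hxb ht.symm) htb (by rintro rfl; exact hbc ht)
  have sc : τ.SameCycle (σ c) c := sameCycle_apply_of_agree (SameCycle.refl _ _)
    fun t ht htc _ => agree t (by rintro rfl; exact hxc ht.symm) (by rintro rfl; exact hbc ht.symm) htc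
  have r1 : τ.SameCycle x b := by
    refine SameCycle.trans ?_ sb
    rw [← tx, sameCycle_apply_right]
  refine hxb (hσ.2 τ ?_ (fun s t => sameCycle_of_forall_sameCycle ?_) x b r1)
  · intro v
    by_cases vx : v = x
    · rw [vx, tx]
      exact hσ.adj_of_sameCycle hT hsemi hxb (SameCycle.refl _ _)
        (sameCycle_apply_right.2 (SameCycle.refl _ _)) hxb'
    by_cases vb : v = b
    · rw [vb, tb]; exact hbs
    by_cases vc : v = c
    · rw [vc, tc]
      exact hσ.adj_of_sameCycle hT hsemi (fun h => hxs h.symm)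
        (sameCycle_apply_left.2 (SameCycle.refl _ _)) (sameCycle_apply_right.2 (SameCycle.refl _ _)) hsx
    rw [agree v vx vb vc]; exact hσ.1 v
  · intro t
    by_cases vx : t = x
    · rw [vx]; exact sx.symm
    by_cases vb : t = b
    · rw [vb]; exact sb.symm
    by_cases vc : t = c
    · rw [vc]; exact sc.symm
    rw [← agree t vx vb vc, sameCycle_apply_right]

end Maximal

/-- An extension of a strong semicomplete digraph that has a cycle factor is hamiltonian. -/
theorem exists_isArcPerm_sameCycle {ι α : Type*} [Finite α] {T : Digraph ι} {cl : α → ι}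
    (hT : Loopless T) (hsemi : Semicomplete T) (hstrong : Strong T)
    (hcl : Function.Surjective cl) {σ : Equiv.Perm α} (hσ : IsArcPerm T cl σ) :
    ∃ τ : Equiv.Perm α, IsArcPerm T cl τ ∧ ∀ x y, τ.SameCycle x y := by
  classical
  obtain ⟨τ, hτ, hmax⟩ := Set.exists_max_image {τ : Equiv.Perm α | IsArcPerm T cl τ}
    (fun τ => {p : α × α | τ.SameCycle p.1 p.2}.ncard) (Set.toFinite _) ⟨σ, hσ⟩
  refine ⟨τ, hτ, IsMergeMaximal.sameCycle hT hsemi hstrong ⟨hτ, fun ρ hρ h s t hst => ?_⟩ hcl⟩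
  have hsub : {p : α × α | τ.SameCycle p.1 p.2} ⊆ {p : α × α | ρ.SameCycle p.1 p.2} :=
    fun p hp => h _ _ hp
  have heq := Set.eq_of_subset_of_ncard_le hsub (hmax ρ hρ) (Set.toFinite _)
  have : (s, t) ∈ {p : α × α | ρ.SameCycle p.1 p.2} := hst
  rw [← heq] at this
  exact this

/-! ### Cyclic lists and permutations -/

theorem rel_formPerm_of_chain {α : Type*} [DecidableEq α] {R : α → α → Prop} {l : List α}
    (hl : l.Nodup) (hc : Cycle.Chain R (l : Cycle α)) {x : α} (hx : x ∈ l) :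
    R x (l.formPerm x) := by
  obtain ⟨s, t, rfl⟩ := List.append_of_mem hx
  have hr : (s ++ x :: t) ~r (x :: t ++ s) := List.isRotated_append
  rw [List.formPerm_eq_of_isRotated hl hr]
  rw [Cycle.coe_eq_coe.2 hr] at hc
  replace hl := hr.nodup_iff.1 hl
  rw [List.cons_append] at hl hc ⊢
  rw [Cycle.chain_coe_cons] at hc
  cases h : t ++ s with
  | nil => simpa [h] using hc
  | cons y r =>
    rw [h] at hc hl
    rw [List.formPerm_apply_head _ _ _ hl]
    exact (List.isChain_cons_cons.1 hc).1

theorem exists_nodup_isChain_of_reflTransGen {α : Type*} {R : α → α → Prop} {a b : α}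
    (h : Relation.ReflTransGen R a b) :
    ∃ l : List α, (a :: l).Nodup ∧ (a :: l).IsChain R ∧
      (a :: l).getLast (List.cons_ne_nil _ _) = b := by
  induction h using Relation.ReflTransGen.head_induction_on with
  | refl => exact ⟨[], by simp⟩
  | @head a c hac _ ih =>
    obtain ⟨l, h1, h2, h3⟩ := ih
    by_cases ha : a ∈ c :: l
    · obtain ⟨s, t, hst⟩ := List.append_of_mem ha
      refine ⟨t, ?_, ?_, ?_⟩
      · rw [hst] at h1; exact h1.of_append_right
      · rw [hst] at h2; exact h2.right_of_append
      · rw [← h3]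
        simp [hst]
    · refine ⟨c :: l, List.nodup_cons.2 ⟨ha, h1⟩, List.isChain_cons_cons.2 ⟨hac, h2⟩, ?_⟩
      rw [← h3, List.getLast_cons]

/-- A closed walk through `v` contains a cycle through `v`. -/
theorem exists_perm_of_transGen {α : Type*} {R : α → α → Prop} {v : α}
    (h : Relation.TransGen R v v) :
    ∃ ρ : Equiv.Perm α, (∀ a, ρ a = a ∨ R a (ρ a)) ∧ R v (ρ v) := by
  classical
  obtain ⟨b, hvb, hbv⟩ := Relation.TransGen.tail'_iff.1 h
  obtain ⟨l, h1, h2, h3⟩ := exists_nodup_isChain_of_reflTransGen hvb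
  have hc : Cycle.Chain R ((v :: l : List α) : Cycle α) := by
    rw [Cycle.chain_coe_cons, ← List.cons_append]
    refine List.isChain_append.2 ⟨h2, List.isChain_singleton _, ?_⟩
    intro x hx y hy
    rw [List.getLast?_eq_getLast_of_ne_nil (List.cons_ne_nil _ _), h3] at hx
    simp only [Option.mem_def, Option.some.injEq, List.head?_cons] at hx hy
    rwa [← hx, ← hy]
  refine ⟨(v :: l).formPerm, fun a => ?_, rel_formPerm_of_chain h1 hc (by simp)⟩
  by_cases ha : a ∈ v :: l
  · exact Or.inr (rel_formPerm_of_chain h1 hc ha)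
  · exact Or.inl (List.formPerm_apply_of_notMem ha)

theorem isChain_iterate {α : Type*} {R : α → α → Prop} {f : α → α} (h : ∀ x, R x (f x)) (n : ℕ)
    (x : α) : (List.iterate f x n).IsChain R := by
  induction n generalizing x with
  | zero => simp
  | succ n ih =>
    cases n with
    | zero => simp
    | succ n => exact List.isChain_cons_cons.2 ⟨h x, ih (f x)⟩

/-- A permutation with a single cycle, none of whose points is fixed, as a cyclic list. -/
theorem exists_cyclic_list_of_sameCycle {α : Type*} [Finite α] [Nonempty α] {R : α → α → Prop}
    {σ : Equiv.Perm α} (h : ∀ x, R x (σ x)) (hσ : ∀ x y, σ.SameCycle x y) :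
    ∃ l : List α, l.Nodup ∧ (∀ x, x ∈ l) ∧ Cycle.Chain R (l : Cycle α) := by
  classical
  have := Fintype.ofFinite α
  obtain ⟨x⟩ := ‹Nonempty α›
  have hex : ∃ n : ℕ, 0 < n ∧ (σ ^ n) x = x :=
    ⟨orderOf σ, orderOf_pos σ, by simp [pow_orderOf_eq_one]⟩
  obtain ⟨hpos, hn⟩ := Nat.find_spec hex
  have hmin : ∀ m, m < Nat.find hex → ¬ (0 < m ∧ (σ ^ m) x = x) := fun m => Nat.find_min hex
  set n := Nat.find hex
  have hmem : ∀ y, y ∈ List.iterate σ x n ↔ ∃ m < n, (σ ^ m) x = y := by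
    intro y
    simp [List.mem_iterate, Equiv.Perm.iterate_eq_pow, eq_comm]
  refine ⟨List.iterate σ x n, ?_, ?_, ?_⟩
  · rw [List.nodup_iff_injective_get]
    have inj : ∀ i j : ℕ, i < j → j < n → (σ ^ i) x ≠ (σ ^ j) x := by
      intro i j hij hj he
      refine hmin (j - i) (by omega) ⟨by omega, ?_⟩
      rw [← Nat.add_sub_cancel' hij.le, pow_add, Equiv.Perm.mul_apply] at he
      exact ((σ ^ i).injective he).symm
    intro ⟨i, hi⟩ ⟨j, hj⟩ he
    simp only [List.length_iterate] at hi hj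
    simp only [List.get_eq_getElem, List.getElem_iterate, Equiv.Perm.iterate_eq_pow] at he
    rcases lt_trichotomy i j with h1 | h1 | h1
    · exact (inj i j h1 hj he).elim
    · simp [h1]
    · exact (inj j i h1 hi he.symm).elim
  · intro y
    rw [hmem]
    obtain ⟨k, rfl⟩ := (hσ x y).exists_nat_pow_eq
    refine ⟨k % n, Nat.mod_lt _ hpos, ?_⟩
    conv_rhs => rw [← Nat.mod_add_div k n, pow_add, Equiv.Perm.mul_apply, pow_mul]
    congr 1
    have : ∀ m : ℕ, ((σ ^ n) ^ m) x = x := by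
      intro m
      induction m with
      | zero => simp
      | succ m ih => rw [pow_succ, Equiv.Perm.mul_apply, hn, ih]
    exact (this _).symm
  · obtain ⟨m, hm⟩ := Nat.exists_eq_succ_of_ne_zero hpos.ne'
    have h1 := isChain_iterate h (n + 1) x
    rw [List.iterate_add, Equiv.Perm.iterate_eq_pow, hn] at h1
    rw [hm] at h1 ⊢
    rw [List.iterate, Cycle.chain_coe_cons]
    simpa [List.iterate] using h1

/-! ### Cycle subdigraphs of extensions -/

section Fullest

variable {ι α : Type*} {T : Digraph ι} {cl : α → ι}

/-- The permutation `f` encodes a cycle subdigraph of the digraph obtained from `T` by replacing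
each vertex `i` by the independent set `cl ⁻¹' {i}`: the points that `f` fixes are those not
covered. -/
def IsPartialArcPerm (T : Digraph ι) (cl : α → ι) (f : Equiv.Perm α) : Prop :=
  ∀ v, f v = v ∨ T.Adj (cl v) (cl (f v))

/-- A cycle subdigraph can be relabelled within a class. -/
theorem IsPartialArcPerm.exists_relabel [Finite α] {f g : Equiv.Perm α}
    (hg : IsPartialArcPerm T cl g) {i : ι}
    (h : {v | cl v = i ∧ f v ≠ v}.ncard < {v | cl v = i ∧ g v ≠ v}.ncard) :
    ∃ g', IsPartialArcPerm T cl g' ∧ (∀ a, cl a = i → f a ≠ a → g' a ≠ a) ∧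
      ∃ v, cl v = i ∧ f v = v ∧ g' v ≠ v := by
  classical
  have := Fintype.ofFinite α
  let C := {v // cl v = i}
  let A : Finset C := Finset.univ.filter fun v => f v ≠ v
  let B : Finset C := Finset.univ.filter fun v => g v ≠ v
  have hcard : ∀ k : Equiv.Perm α, {v | cl v = i ∧ k v ≠ v}.ncard =
      (Finset.univ.filter fun v : C => k v ≠ v).card := by
    intro k
    rw [← Set.ncard_coe_finset, ← Set.ncard_image_of_injective _ Subtype.val_injective]
    congr 1
    ext v
    simp [C, and_comm]
  have hAB : A.card < B.card := by rw [← hcard, ← hcard]; exact h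
  obtain ⟨B', hB', hA⟩ := Finset.exists_subset_card_eq hAB.le
  obtain ⟨b, hb, hbB'⟩ := Finset.exists_mem_notMem_of_card_lt_card (hA.trans_lt hAB)
  let e : {x // x ∈ A} ≃ {x // x ∈ B'} := Finset.equivOfCardEq hA.symm
  let π' : Equiv.Perm C := e.extendSubtype
  have hπ' : ∀ x, x ∈ A → π' x ∈ B' := fun x hx => e.extendSubtype_mem x hx
  let π : Equiv.Perm α := ofSubtype π'
  have hπ : ∀ x : C, π x = π' x := fun x => ofSubtype_apply_coe π' x
  have hcl : ∀ v, cl (π v) = cl v := by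
    intro v
    by_cases hv : cl v = i
    · have := hπ ⟨v, hv⟩
      simp only at this
      rw [this, (π' _).2, hv]
    · have : π v = v := ofSubtype_apply_of_not_mem π' hv
      rw [this]
  have hfix : ∀ v, (π⁻¹ * g * π) v = v ↔ g (π v) = π v := by
    intro v
    simp only [Equiv.Perm.mul_apply, Equiv.Perm.inv_eq_iff_eq]
  refine ⟨π⁻¹ * g * π, ?_, ?_, ((π'.symm b : C) : α), (π'.symm b).2, ?_, ?_⟩
  · intro v
    rw [hfix]
    refine (hg (π v)).imp_right fun h => ?_
    rw [hcl] at h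
    rw [← hcl ((π⁻¹ * g * π) v)]
    simpa using h
  · intro a ha hfa
    rw [Ne, hfix]
    have h1 : π' ⟨a, ha⟩ ∈ B := hB' (hπ' _ (by simpa [A] using hfa))
    have h2 : π a = _ := hπ ⟨a, ha⟩
    rw [h2]
    simpa [B] using h1
  · by_contra hf
    have := hπ' (π'.symm b) (by simpa [A] using hf)
    rw [Equiv.apply_symm_apply] at this
    exact hbB' this
  · rw [Ne, hfix, hπ, Equiv.apply_symm_apply]
    simpa [B] using hb

/-- The augmentation step: if a cycle subdigraph does not cover the largest possible number of
vertices of the class `i`, then it can be modified to cover more vertices without uncovering any.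

A comparison with a better cycle subdigraph yields an alternating closed walk through an uncovered
vertex `v` of the class `i`. A step at which this walk would uncover a vertex `a` outside the
class `i` can be avoided by a shortcut, since `a` is adjacent to `v`. -/
theorem IsPartialArcPerm.exists_augment [Finite α] (hT : Loopless T) (hsemi : Semicomplete T)
    {f g : Equiv.Perm α} (hf : IsPartialArcPerm T cl f) (hg : IsPartialArcPerm T cl g) {i : ι}
    (h : {v | cl v = i ∧ f v ≠ v}.ncard < {v | cl v = i ∧ g v ≠ v}.ncard) :
    ∃ f', IsPartialArcPerm T cl f' ∧ {v | f v ≠ v} ⊂ {v | f' v ≠ v} := by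
  obtain ⟨g, hg, hsub, v, hvi, hfv, hgv⟩ := hg.exists_relabel h
  set k := f⁻¹ * g with hk
  have hfk : ∀ a, f (k a) = g a := by simp [hk]
  let R : α → α → Prop := fun a b => T.Adj (cl a) (cl (f b)) ∨ (f b = a ∧ cl a ≠ i)
  let R' : α → α → Prop := fun a b => T.Adj (cl a) (cl (f b))
  have hkv : k v ≠ v := by
    intro h
    have := hfk v
    rw [h, hfv] at this
    exact hgv this.symm
  have hR : ∀ a, k.SameCycle v a → R a (k a) := by
    intro a ha
    simp only [R, hfk]
    refine (hg a).symm.imp_right fun hga => ⟨hga, fun hai => ?_⟩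
    have hfa : f a = a := by_contra fun hfa => hsub a hai hfa hga
    have hka : k a = a := f.injective (by rw [hfk, hga, hfa])
    exact hkv (ha.apply_eq_self_iff.2 hka)
  have hvv : Relation.TransGen R v v := by
    have : ∀ n : ℕ, Relation.TransGen R v ((k ^ (n + 1)) v) := by
      intro n
      induction n with
      | zero => simpa using Relation.TransGen.single (hR v (SameCycle.refl _ _))
      | succ n ih =>
        rw [pow_succ', Equiv.Perm.mul_apply]
        exact ih.tail (hR _ (by simp [SameCycle.refl]))
    have h1 := this (orderOf k - 1)
    rwa [Nat.sub_add_cancel (orderOf_pos k), pow_orderOf_eq_one] at h1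
  have hvv' : Relation.TransGen R' v v := by
    have key : ∀ b, Relation.TransGen R v b →
        Relation.TransGen R' v b ∨ Relation.TransGen R' v v := by
      have step : ∀ a b, (Relation.ReflTransGen R' v a) → R a b →
          Relation.TransGen R' v b ∨ Relation.TransGen R' v v := by
        rintro a b hva (hab | ⟨rfl, hai⟩)
        · exact Or.inl (Relation.TransGen.tail' hva hab)
        · rcases hsemi _ _ (fun h => hai (h.symm.trans hvi) : cl v ≠ cl (f b)) with h1 | h1
          · exact Or.inl (Relation.TransGen.single h1)
          · refine Or.inr (Relation.TransGen.tail' hva ?_)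
            change T.Adj _ (cl (f v))
            rwa [hfv]
      intro b hb
      induction hb with
      | single h => exact step _ _ Relation.ReflTransGen.refl h
      | tail _ h ih =>
        rcases ih with ih | ih
        · exact step _ _ ih.to_reflTransGen h
        · exact Or.inr ih
    exact (key v hvv).elim id id
  obtain ⟨ρ, hρ, hρv⟩ := exists_perm_of_transGen hvv'
  have hne : ∀ a, R' a (ρ a) → (f * ρ) a ≠ a := by
    intro a ha h
    change T.Adj (cl a) (cl ((f * ρ) a)) at ha
    rw [h] at ha
    exact hT _ ha
  refine ⟨f * ρ, fun a => ?_, Set.ssubset_iff_of_subset (fun a ha => ?_) |>.2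
    ⟨v, hne v hρv, by simpa using hfv⟩⟩
  · rcases hρ a with h | h
    · rw [Equiv.Perm.mul_apply, h]
      exact hf a
    · exact Or.inr h
  · rcases hρ a with h | h
    · simp only [Set.mem_ofPred_eq, Equiv.Perm.mul_apply, h]
      exact ha
    · exact hne a h

/-- There is a cycle subdigraph of an extension of a semicomplete digraph that covers the largest
possible number of vertices in all classes simultaneously. -/
theorem exists_isPartialArcPerm_ncard_le [Finite α] (hT : Loopless T) (hsemi : Semicomplete T)
    (cl : α → ι) : ∃ f : Equiv.Perm α, IsPartialArcPerm T cl f ∧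
      ∀ g : Equiv.Perm α, IsPartialArcPerm T cl g → ∀ i,
        {v | cl v = i ∧ g v ≠ v}.ncard ≤ {v | cl v = i ∧ f v ≠ v}.ncard := by
  classical
  obtain ⟨f, hf, hmax⟩ := Set.exists_max_image {f : Equiv.Perm α | IsPartialArcPerm T cl f}
    (fun f => {v | f v ≠ v}.ncard) (Set.toFinite _) ⟨1, fun v => Or.inl rfl⟩
  refine ⟨f, hf, fun g hg i => ?_⟩
  by_contra! h
  obtain ⟨f', hf', hlt⟩ := IsPartialArcPerm.exists_augment hT hsemi hf hg h
  exact (Set.ncard_lt_ncard hlt (Set.toFinite _)).not_ge (hmax f' hf')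

theorem exists_isPartialArcPerm_apply_ne [Nontrivial ι] (hT : Loopless T) (hstrong : Strong T)
    (hcl : Function.Surjective cl) (v : α) :
    ∃ g : Equiv.Perm α, IsPartialArcPerm T cl g ∧ g v ≠ v := by
  classical
  obtain ⟨j, hj⟩ := exists_ne (cl v)
  let s : ι → α := Function.update (Function.surjInv hcl) (cl v) v
  have hs : ∀ i, cl (s i) = i := by
    intro i
    by_cases hi : i = cl v
    · simp [s, hi]
    · simp [s, hi, Function.surjInv_eq]
  have h1 : Relation.TransGen T.Adj (cl v) (cl v) :=
    ((Relation.reflTransGen_iff_eq_or_transGen.1 (hstrong (cl v) j)).resolve_left hj).trans_left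
      (hstrong _ _)
  have h2 : Relation.TransGen (fun a b => T.Adj (cl a) (cl b)) (s (cl v)) (s (cl v)) :=
    by
    refine Relation.TransGen.lift (p := fun a b => T.Adj (cl a) (cl b)) s (fun a b hab => ?_) _ _ h1
    simpa [Function.onFun, hs] using hab
  rw [show s (cl v) = v by simp [s]] at h2
  obtain ⟨ρ, hρ, hρv⟩ := exists_perm_of_transGen h2
  exact ⟨ρ, hρ, fun h => hT (cl v) (by rwa [h] at hρv)⟩

/-- In an extension of a strong semicomplete digraph, a single cycle covers the largest possible
number of vertices in all classes simultaneously. -/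
theorem exists_cyclic_list_ncard_le [Finite α] [Nontrivial ι] (hT : Loopless T)
    (hsemi : Semicomplete T) (hstrong : Strong T) (hcl : Function.Surjective cl) :
    ∃ l : List α, l.Nodup ∧ (∀ i, ∃ v ∈ l, cl v = i) ∧
      Cycle.Chain (fun a b => T.Adj (cl a) (cl b)) (l : Cycle α) ∧
      ∀ g : Equiv.Perm α, IsPartialArcPerm T cl g → ∀ i,
        {v | cl v = i ∧ g v ≠ v}.ncard ≤ {v | cl v = i ∧ v ∈ l}.ncard := by
  obtain ⟨f, hf, hmax⟩ := exists_isPartialArcPerm_ncard_le hT hsemi cl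
  have hmem : ∀ v, f v ≠ v ↔ f (f v) ≠ f v := fun v => (f.injective.ne_iff).symm
  have hsurj : Function.Surjective fun v : {v // f v ≠ v} => cl v := by
    intro i
    obtain ⟨v, rfl⟩ := hcl i
    obtain ⟨g, hg, hgv⟩ := exists_isPartialArcPerm_apply_ne hT hstrong hcl v
    have h1 : 0 < {w | cl w = cl v ∧ g w ≠ w}.ncard :=
      (Set.ncard_pos (Set.toFinite _)).2 ⟨v, rfl, hgv⟩
    obtain ⟨w, hw, hfw⟩ := (Set.ncard_pos (Set.toFinite _)).1 (h1.trans_le (hmax g hg _))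
    exact ⟨⟨w, hfw⟩, hw⟩
  have hσ : IsArcPerm T (fun v : {v // f v ≠ v} => cl v)
      (f.subtypePerm fun v => (hmem v).symm) := by
    intro v
    exact (hf v).resolve_left v.2
  obtain ⟨τ, hτ, htrans⟩ := exists_isArcPerm_sameCycle hT hsemi hstrong hsurj hσ
  have : Nonempty {v // f v ≠ v} := by
    obtain ⟨i⟩ := (inferInstance : Nonempty ι)
    exact ⟨(hsurj i).choose⟩
  obtain ⟨l, hl, hall, hc⟩ := exists_cyclic_list_of_sameCycle
    (R := fun a b : {v // f v ≠ v} => T.Adj (cl a) (cl b)) hτ htrans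
  refine ⟨l.map Subtype.val, hl.map Subtype.val_injective, fun i => ?_, ?_, fun g hg i => ?_⟩
  · obtain ⟨v, rfl⟩ := hsurj i
    exact ⟨v, List.mem_map_of_mem (hall v), rfl⟩
  · rw [← Cycle.map_coe, Cycle.chain_map]
    exact hc
  · refine (hmax g hg i).trans_eq ?_
    congr 1
    ext v
    simp [hall]

end Fullest

end Permutations

/-! ### Path-cycle factors as lists -/

/-- The lists in `L` and `K` are the vertex sequences of the paths and cycles of a path-cycle
subdigraph of `D`; the condition `nodup` says that these are pairwise disjoint. -/
structure IsPathCycleList {V : Type*} (D : Digraph V) (L K : List (List V)) : Prop where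
  isPath : ∀ l ∈ L, IsPath D l
  isCycle : ∀ l ∈ K, IsCycle D (l : Cycle V)
  nodup : (L ++ K).flatten.Nodup

theorem IsCycle.isChain {V : Type*} {D : Digraph V} {l : List V}
    (h : IsCycle D (l : Cycle V)) : l.IsChain D.Adj := by
  cases l with
  | nil => exact List.isChain_nil
  | cons a l =>
    have := h.2.2
    rw [Cycle.chain_coe_cons, ← List.cons_append] at this
    exact this.left_of_append

theorem IsCycle.ne_nil {V : Type*} {D : Digraph V} {l : List V}
    (h : IsCycle D (l : Cycle V)) : l ≠ [] := by
  rintro rfl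
  have := Cycle.length_nontrivial h.1
  simp at this

theorem IsCycle.isPath {V : Type*} {D : Digraph V} {l : List V}
    (h : IsCycle D (l : Cycle V)) : IsPath D l :=
  ⟨h.ne_nil, Cycle.nodup_coe_iff.1 h.2.1, h.isChain⟩

/-- Without loops, a closed walk without repeated vertices is a cycle of length at least two. -/
theorem isCycle_of_chain {V : Type*} {D : Digraph V} (hD : Loopless D) {l : List V} (hne : l ≠ [])
    (hl : l.Nodup) (hc : Cycle.Chain D.Adj (l : Cycle V)) : IsCycle D (l : Cycle V) := by
  refine ⟨(Cycle.nontrivial_coe_nodup_iff hl).2 ?_, Cycle.nodup_coe_iff.2 hl, hc⟩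
  match l, hne with
  | [a], _ => exact (hD a (by simpa using hc)).elim
  | a :: b :: l, _ => simp

theorem IsPathCycleList.exists_pathCycleSubdigraph {V : Type*} {D : Digraph V}
    {L K : List (List V)} (h : IsPathCycleList D L K) :
    ∃ S : PathCycleSubdigraph D L.length K.length, S.verts = {x | x ∈ (L ++ K).flatten} := by
  have hp := (List.nodup_flatten.1 h.nodup).2
  rw [List.pairwise_append] at hp
  obtain ⟨hL, hK, hLK⟩ := hp
  have hget : ∀ M : List (List V), M.Pairwise List.Disjoint → ∀ a b : Fin M.length, a ≠ b →
      Disjoint {x | x ∈ M.get a} {x | x ∈ M.get b} := by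
    intro M hM a b hab
    rw [Set.disjoint_left]
    rcases lt_or_gt_of_ne hab with h | h
    · exact fun x ha hb => List.pairwise_iff_get.1 hM a b h ha hb
    · exact fun x ha hb => List.pairwise_iff_get.1 hM b a h hb ha
  refine ⟨⟨L.get, fun b => (K.get b : Cycle V), fun a => h.isPath _ (L.get_mem a),
    fun b => h.isCycle _ (K.get_mem b), ?_⟩, ?_⟩
  · rintro (a | a) (b | b) hab
    · exact hget L hL a b fun h => hab (h ▸ rfl)
    · exact Set.disjoint_left.2 fun x ha hb => hLK _ (L.get_mem a) _ (K.get_mem b) ha hb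
    · exact Set.disjoint_left.2 fun x ha hb => hLK _ (L.get_mem b) _ (K.get_mem a) hb ha
    · exact hget K hK a b fun h => hab (h ▸ rfl)
  · ext x
    simp only [PathCycleSubdigraph.verts, Set.mem_ofPred_eq, List.flatten_append, List.mem_append,
      List.mem_flatten, Cycle.mem_coe_iff]
    refine or_congr ⟨?_, ?_⟩ ⟨?_, ?_⟩
    · rintro ⟨a, ha⟩; exact ⟨_, L.get_mem a, ha⟩
    · rintro ⟨l, hl, hx⟩
      obtain ⟨a, rfl⟩ := List.mem_iff_get.1 hl
      exact ⟨a, hx⟩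
    · rintro ⟨a, ha⟩; exact ⟨_, K.get_mem a, ha⟩
    · rintro ⟨l, hl, hx⟩
      obtain ⟨a, rfl⟩ := List.mem_iff_get.1 hl
      exact ⟨a, hx⟩

theorem PathCycleSubdigraph.exists_isPathCycleList {V : Type*} {D : Digraph V} {k t : ℕ}
    (S : PathCycleSubdigraph D k t) :
    ∃ L K : List (List V), L.length = k ∧ K.length = t ∧ IsPathCycleList D L K ∧
      S.verts = {x | x ∈ (L ++ K).flatten} := by
  have hout : ∀ b, ((Quotient.out (S.cycle b) : List V) : Cycle V) = S.cycle b :=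
    fun b => Quotient.out_eq _
  have hmem : ∀ b x, x ∈ (Quotient.out (S.cycle b) : List V) ↔ x ∈ S.cycle b := by
    intro b x
    rw [← Cycle.mem_coe_iff, hout]
  refine ⟨List.ofFn S.path, List.ofFn fun b => Quotient.out (S.cycle b), by simp, by simp,
    ⟨?_, ?_, ?_⟩, ?_⟩
  · intro l hl
    obtain ⟨a, rfl⟩ := (List.mem_ofFn' _ _).1 hl
    exact S.isPath a
  · intro l hl
    obtain ⟨b, rfl⟩ := (List.mem_ofFn' _ _).1 hl
    rw [hout]
    exact S.isCycle b
  · rw [List.nodup_flatten, List.pairwise_append]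
    refine ⟨?_, ?_, ?_, ?_⟩
    · intro l hl
      rcases List.mem_append.1 hl with hl | hl
      · obtain ⟨a, rfl⟩ := (List.mem_ofFn' _ _).1 hl
        exact (S.isPath a).2.1
      · obtain ⟨b, rfl⟩ := (List.mem_ofFn' _ _).1 hl
        rw [← Cycle.nodup_coe_iff, hout]
        exact (S.isCycle b).2.1
    · rw [List.pairwise_ofFn]
      intro a b hab x ha hb
      exact Set.disjoint_left.1 (S.disjoint (i := Sum.inl a) (j := Sum.inl b)
        fun h => hab.ne (Sum.inl.inj h)) ha hb
    · rw [List.pairwise_ofFn]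
      intro a b hab x ha hb
      exact Set.disjoint_left.1 (S.disjoint (i := Sum.inr a) (j := Sum.inr b)
        fun h => hab.ne (Sum.inr.inj h)) ((hmem _ _).1 ha) ((hmem _ _).1 hb)
    · intro l hl m hm x hx hx'
      obtain ⟨a, rfl⟩ := (List.mem_ofFn' _ _).1 hl
      obtain ⟨b, rfl⟩ := (List.mem_ofFn' _ _).1 hm
      exact Set.disjoint_left.1 (S.disjoint (i := Sum.inl a) (j := Sum.inr b) (by simp)) hx
        ((hmem _ _).1 hx')
  · ext x
    simp [PathCycleSubdigraph.verts, List.mem_flatten, List.mem_ofFn, hmem]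

theorem hasPathCycleFactor_iff {V : Type*} {D : Digraph V} {k t : ℕ} :
    HasPathCycleFactor D k t ↔ ∃ L K : List (List V), L.length = k ∧ K.length = t ∧
      IsPathCycleList D L K ∧ ∀ x, x ∈ (L ++ K).flatten := by
  constructor
  · rintro ⟨S, hS⟩
    obtain ⟨L, K, hL, hK, h, hv⟩ := S.exists_isPathCycleList
    refine ⟨L, K, hL, hK, h, fun x => ?_⟩
    have : x ∈ S.verts := hS ▸ Set.mem_univ x
    rwa [hv] at this
  · rintro ⟨L, K, rfl, rfl, h, hall⟩
    obtain ⟨S, hS⟩ := h.exists_pathCycleSubdigraph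
    exact ⟨S, hS.trans (Set.eq_univ_of_forall hall)⟩

/-- A cycle becomes a path when one of its arcs is deleted. -/
theorem HasPathCycleFactor.open_cycle {V : Type*} {D : Digraph V} {p j : ℕ}
    (h : HasPathCycleFactor D p (j + 1)) : HasPathCycleFactor D (p + 1) j := by
  obtain ⟨L, K, rfl, hK, h, hall⟩ := hasPathCycleFactor_iff.1 h
  obtain ⟨l, K, rfl⟩ := List.exists_cons_of_length_eq_add_one hK
  have hperm : (L ++ l :: K).flatten.Perm ((l :: L) ++ K).flatten :=
    List.Perm.flatten List.perm_middle
  refine hasPathCycleFactor_iff.2 ⟨l :: L, K, rfl, by simpa using hK,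
    ⟨?_, fun m hm => h.isCycle m (List.mem_cons_of_mem _ hm), hperm.nodup_iff.1 h.nodup⟩,
    fun x => hperm.mem_iff.1 (hall x)⟩
  intro m hm
  rcases List.mem_cons.1 hm with rfl | hm
  · exact (h.isCycle _ (by simp)).isPath
  · exact h.isPath m hm

theorem HasPathCycleFactor.split_path {V : Type*} [Fintype V] {D : Digraph V} {p : ℕ}
    (h : HasPathCycleFactor D p 0) (hp : p < Fintype.card V) :
    HasPathCycleFactor D (p + 1) 0 := by
  classical
  obtain ⟨L, K, rfl, hK, h, hall⟩ := hasPathCycleFactor_iff.1 h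
  obtain rfl := List.length_eq_zero_iff.1 hK
  rw [List.append_nil] at hall
  have hlen : Fintype.card V ≤ L.flatten.length := by
    rw [← Finset.card_univ, ← show L.flatten.toFinset = Finset.univ by
      ext x; simpa only [List.mem_toFinset, Finset.mem_univ, iff_true] using hall x]
    exact List.toFinset_card_le _
  obtain ⟨l, hl, hl2⟩ : ∃ l ∈ L, 2 ≤ l.length := by
    by_contra! hno
    have : L.flatten.length ≤ L.length := by
      rw [List.length_flatten]
      refine (List.sum_le_card_nsmul _ 1 ?_).trans (by simp)
      intro n hn
      obtain ⟨l, hl, rfl⟩ := List.mem_map.1 hn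
      exact Nat.le_of_lt_succ (hno l hl)
    omega
  obtain ⟨s, t, rfl⟩ := List.append_of_mem hl
  obtain ⟨a, b, r, rfl⟩ : ∃ a b r, l = a :: b :: r := by
    match l, hl2 with
    | a :: b :: r, _ => exact ⟨a, b, r, rfl⟩
  have hflat : (s ++ (a :: b :: r) :: t).flatten = (s ++ [a] :: (b :: r) :: t).flatten := by simp
  have hpath := h.isPath _ hl
  refine hasPathCycleFactor_iff.2 ⟨s ++ [a] :: (b :: r) :: t, [], by simp; omega, rfl,
    ⟨?_, by simp, ?_⟩, ?_⟩
  · intro m hm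
    simp only [List.mem_append, List.mem_cons] at hm
    rcases hm with hm | rfl | rfl | hm
    · exact h.isPath m (by simp [hm])
    · simp [IsPath]
    · exact ⟨by simp, (List.nodup_cons.1 hpath.2.1).2, (List.isChain_cons_cons.1 hpath.2.2).2⟩
    · exact h.isPath m (by simp [hm])
  · rw [List.append_nil, ← hflat]
    simpa using h.nodup
  · rw [List.append_nil, ← hflat]
    exact hall

theorem hasPathCycleFactor_of_pc_le {V : Type*} [Fintype V] {D : Digraph V} {m : ℕ}
    (h1 : pc D ≤ m) (h2 : m ≤ Fintype.card V) : HasPathCycleFactor D m 0 := by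
  induction m, h1 using Nat.le_induction with
  | base => exact hasPathCycleFactor_pc D
  | succ m _ ih => exact (ih (by omega)).split_path h2

theorem eta_le_iff {V : Type*} {D : Digraph V} {j m : ℕ} :
    eta D j ≤ m ↔ ∃ p ≤ m, HasPathCycleFactor D p j := by
  constructor
  · intro h
    have h' : eta D j < ((m + 1 : ℕ) : ℕ∞) := lt_of_le_of_lt h (by exact_mod_cast Nat.lt_succ_self m)
    simp only [eta, iInf_lt_iff] at h'
    obtain ⟨p, hp, hlt⟩ := h'
    exact ⟨p, Nat.le_of_lt_succ (by exact_mod_cast hlt), hp⟩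
  · rintro ⟨p, hp, h⟩
    exact (iInf₂_le p h).trans (by exact_mod_cast hp)

/-- Since `η_j` decreases by at most one when `j` increases by one, and `η_0 = pc > m`, the least `j`
with `η_j ≤ m` satisfies `η_j = m`. -/
theorem exists_eta_eq {V : Type*} {D : Digraph V} {m j₀ p₀ : ℕ} (hm : m < pc D) (hp₀ : p₀ ≤ m)
    (h : HasPathCycleFactor D p₀ j₀) :
    {j : ℕ | eta D j = m}.Nonempty ∧ HasPathCycleFactor D m (sInf {j : ℕ | eta D j = m}) ∧
      ∀ j, (∃ p ≤ m, HasPathCycleFactor D p j) → sInf {j : ℕ | eta D j = m} ≤ j := by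
  classical
  have hex : ∃ j, ∃ p ≤ m, HasPathCycleFactor D p j := ⟨j₀, p₀, hp₀, h⟩
  obtain ⟨p, hpm, hp⟩ := Nat.find_spec hex
  have hmin : ∀ j, (∃ p ≤ m, HasPathCycleFactor D p j) → Nat.find hex ≤ j :=
    fun j hj => Nat.find_min' hex hj
  set n := Nat.find hex
  have hpeq : ∀ p ≤ m, HasPathCycleFactor D p n → p = m := by
    intro p hpm hp
    by_contra hne
    cases hn : n with
    | zero =>
      rw [hn] at hp
      exact (hm.trans_le (Nat.sInf_le hp)).not_ge hpm
    | succ k =>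
      rw [hn] at hp
      have := hmin k ⟨p + 1, by omega, hp.open_cycle⟩
      omega
  have heta : eta D n = m := by
    refine le_antisymm (eta_le_iff.2 ⟨p, hpm, hp⟩) (le_iInf₂ fun q hq => ?_)
    by_cases hqm : q ≤ m
    · rw [hpeq q hqm hq]
    · exact_mod_cast (not_le.1 hqm).le
  have hinf : sInf {j : ℕ | eta D j = m} = n := by
    have hmem : eta D (sInf {j : ℕ | eta D j = m}) = m :=
      Nat.sInf_mem (s := {j : ℕ | eta D j = m}) ⟨n, heta⟩
    exact le_antisymm (Nat.sInf_le heta) (hmin _ (eta_le_iff.1 hmem.le))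
  rw [hinf]
  exact ⟨⟨n, heta⟩, hpeq p hpm hp ▸ hp, hmin⟩

/-! ### Decomposition of paths and cycles of a composition -/

section Pieces

variable {ι : Type u} {V : ι → Type v}

/-- The concatenation of lists of vertices, each of which lies in a single `V i`, as a list of
vertices of the composition. -/
def joinPieces (X : List (Σ i, List (V i))) : List (Σ i, V i) :=
  X.flatMap fun c => c.2.map (Sigma.mk c.1)

open Classical in
/-- The members of `X` that lie in `V i`. -/
noncomputable def piecesIn (i : ι) (X : List (Σ i, List (V i))) : List (List (V i)) :=
  X.filterMap fun c => if h : c.1 = i then some (h ▸ c.2) else none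

@[simp] theorem joinPieces_nil : joinPieces ([] : List (Σ i, List (V i))) = [] := rfl

@[simp] theorem joinPieces_cons (c : Σ i, List (V i)) (X : List (Σ i, List (V i))) :
    joinPieces (c :: X) = c.2.map (Sigma.mk c.1) ++ joinPieces X := rfl

@[simp] theorem joinPieces_append (X Y : List (Σ i, List (V i))) :
    joinPieces (X ++ Y) = joinPieces X ++ joinPieces Y := List.flatMap_append

@[simp] theorem piecesIn_nil (i : ι) : piecesIn i ([] : List (Σ i, List (V i))) = [] := rfl

@[simp] theorem piecesIn_cons_self (i : ι) (l : List (V i)) (X : List (Σ i, List (V i))) :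
    piecesIn i (⟨i, l⟩ :: X) = l :: piecesIn i X := by
  simp [piecesIn]

theorem piecesIn_cons_of_ne {i j : ι} (h : j ≠ i) (l : List (V j)) (X : List (Σ i, List (V i))) :
    piecesIn i (⟨j, l⟩ :: X) = piecesIn i X := by
  simp [piecesIn, h]

@[simp] theorem piecesIn_append (i : ι) (X Y : List (Σ i, List (V i))) :
    piecesIn i (X ++ Y) = piecesIn i X ++ piecesIn i Y := List.filterMap_append

theorem mem_piecesIn {i : ι} {l : List (V i)} {X : List (Σ i, List (V i))} :
    l ∈ piecesIn i X ↔ ⟨i, l⟩ ∈ X := by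
  induction X with
  | nil => simp
  | cons c X ih =>
    obtain ⟨j, m⟩ := c
    by_cases h : j = i
    · subst h; simp [ih]
    · rw [piecesIn_cons_of_ne h, ih, List.mem_cons]
      refine ⟨Or.inr, fun h' => h'.resolve_left fun h'' => h (congrArg Sigma.fst h'').symm⟩

theorem length_piecesIn [DecidableEq ι] (i : ι) (X : List (Σ i, List (V i))) :
    (piecesIn i X).length = (X.map Sigma.fst).count i := by
  induction X with
  | nil => simp
  | cons c X ih =>
    obtain ⟨j, m⟩ := c
    by_cases h : j = i
    · subst h; simp [ih]
    · rw [piecesIn_cons_of_ne h, ih, List.map_cons, List.count_cons_of_ne h]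

open Classical in
/-- Counting vertices transfers both disjointness and covering between the composition and the
digraphs `H i`. -/
theorem count_joinPieces (i : ι) (x : V i) (X : List (Σ i, List (V i))) :
    (joinPieces X).count ⟨i, x⟩ = (piecesIn i X).flatten.count x := by
  induction X with
  | nil => simp
  | cons c X ih =>
    obtain ⟨j, m⟩ := c
    by_cases h : j = i
    · subst h
      rw [joinPieces_cons, piecesIn_cons_self, List.count_append, List.flatten_cons,
        List.count_append, ih, List.count_map_of_injective _ _ sigma_mk_injective]
    · rw [piecesIn_cons_of_ne h, joinPieces_cons, List.count_append, ih,
        List.count_eq_zero_of_not_mem, zero_add]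
      intro hmem
      obtain ⟨y, -, hy⟩ := List.mem_map.1 hmem
      exact h (congrArg Sigma.fst hy)

theorem mem_joinPieces {i : ι} {x : V i} {X : List (Σ i, List (V i))} :
    ⟨i, x⟩ ∈ joinPieces X ↔ x ∈ (piecesIn i X).flatten := by
  classical
  rw [← List.count_pos_iff, ← List.count_pos_iff, count_joinPieces]

theorem nodup_joinPieces {X : List (Σ i, List (V i))} :
    (joinPieces X).Nodup ↔ ∀ i, (piecesIn i X).flatten.Nodup := by
  classical
  simp only [List.nodup_iff_count_le_one, Sigma.forall, count_joinPieces]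

theorem exists_piecesIn_eq [DecidableEq ι] (cs : List ι) (L : ∀ i, List (List (V i)))
    (h : ∀ i, (L i).length = cs.count i) :
    ∃ X : List (Σ i, List (V i)), X.map Sigma.fst = cs ∧ ∀ i, piecesIn i X = L i := by
  induction cs generalizing L with
  | nil =>
    refine ⟨[], rfl, fun i => ?_⟩
    have := h i
    rw [List.count_nil, List.length_eq_zero_iff] at this
    rw [this, piecesIn_nil]
  | cons j cs ih =>
    have hj := h j
    rw [List.count_cons_self] at hj
    obtain ⟨p, M, hM⟩ := List.exists_cons_of_length_eq_add_one hj
    obtain ⟨X, hX, hL⟩ := ih (Function.update L j M) fun i => by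
      by_cases hi : i = j
      · subst hi
        simpa [hM] using hj
      · rw [Function.update_of_ne hi, h, List.count_cons_of_ne (Ne.symm hi)]
    refine ⟨⟨j, p⟩ :: X, by simp [hX], fun i => ?_⟩
    by_cases hi : i = j
    · subst hi
      rw [piecesIn_cons_self, hL, hM, Function.update_self]
    · rw [piecesIn_cons_of_ne (Ne.symm hi), hL, Function.update_of_ne hi]

theorem exists_piecesIn_eq_of_fintype [Fintype ι] (L : ∀ i, List (List (V i))) :
    ∃ X : List (Σ i, List (V i)), X.length = ∑ i, (L i).length ∧ ∀ i, piecesIn i X = L i := by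
  classical
  let M : Multiset ι := ∑ i, Multiset.replicate (L i).length i
  obtain ⟨X, hX, hL⟩ := exists_piecesIn_eq M.toList L fun i => by
    rw [← Multiset.coe_count, Multiset.coe_toList, Multiset.count_sum']
    simp [Multiset.count_replicate]
  refine ⟨X, ?_, hL⟩
  rw [← List.length_map (as := X) (f := Sigma.fst), hX, Multiset.length_toList, Multiset.card_sum]
  simp

theorem length_eq_sum_length_piecesIn [Fintype ι] (X : List (Σ i, List (V i))) :
    X.length = ∑ i, (piecesIn i X).length := by
  classical
  simp only [length_piecesIn]
  rw [← List.length_map (as := X) (f := Sigma.fst), ← Multiset.coe_card,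
    ← Multiset.sum_count_eq_card (s := Finset.univ) (by simp)]
  simp

variable {T : Digraph ι} {H : ∀ i, Digraph (V i)}

theorem loopless_composition (hT : Loopless T) (hH : ∀ i, Loopless (H i)) :
    Loopless (composition T H) := by
  rintro ⟨i, x⟩ (h | ⟨j, a, b, h1, h2, h⟩)
  · exact hT i h
  · rw [h1] at h2
    obtain rfl := eq_of_heq (Sigma.mk.inj h2).2
    exact hH j a h

theorem extension_adj {x y : Σ i, V i} : (extension V T).Adj x y ↔ T.Adj x.1 y.1 := by
  simp [extension, composition]

theorem loopless_extension (hT : Loopless T) : Loopless (extension V T) := fun x h =>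
  hT x.1 (extension_adj.1 h)

theorem Strong.of_composition [∀ i, Nonempty (V i)] (h : Strong (composition T H)) :
    Strong T := by
  intro i j
  have key : ∀ x y : Σ i, V i, Relation.ReflTransGen (composition T H).Adj x y →
      Relation.ReflTransGen T.Adj x.1 y.1 := by
    intro x y hxy
    induction hxy with
    | refl => exact Relation.ReflTransGen.refl
    | tail _ h ih =>
      rcases h with h | ⟨k, a, b, rfl, rfl, _⟩
      · exact ih.tail h
      · exact ih
  obtain ⟨a⟩ := (inferInstance : Nonempty (V i))
  obtain ⟨b⟩ := (inferInstance : Nonempty (V j))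
  exact key ⟨i, a⟩ ⟨j, b⟩ (h _ _)

/-- Each member of `X` is a walk in some `H i`. -/
def AreWalks (H : ∀ i, Digraph (V i)) (X : List (Σ i, List (V i))) : Prop :=
  ∀ c ∈ X, c.2 ≠ [] ∧ c.2.IsChain (H c.1).Adj

theorem isChain_joinPieces {X : List (Σ i, List (V i))} (hX : AreWalks H X)
    (hc : (X.map Sigma.fst).IsChain T.Adj) :
    (joinPieces X).IsChain (composition T H).Adj := by
  induction X with
  | nil => exact List.isChain_nil
  | cons c X ih =>
    rw [joinPieces_cons, List.isChain_append]
    refine ⟨?_, ih (fun d hd => hX d (List.mem_cons_of_mem _ hd)) hc.tail, ?_⟩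
    · rw [List.isChain_map]
      exact (hX c (by simp)).2.imp fun a b hab => Or.inr ⟨_, a, b, rfl, rfl, hab⟩
    · intro x hx y hy
      obtain ⟨a, -, rfl⟩ := List.mem_map.1 (List.mem_of_mem_getLast? hx)
      cases X with
      | nil => simp at hy
      | cons d X =>
        obtain ⟨j, m⟩ := d
        cases m with
        | nil => exact ((hX ⟨j, []⟩ (by simp)).1 rfl).elim
        | cons b m =>
          simp only [joinPieces_cons, List.map_cons, List.cons_append, List.head?_cons,
            Option.mem_def, Option.some.injEq] at hy
          subst hy
          exact Or.inl (List.isChain_cons_cons.1 hc).1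

theorem isCycle_joinPieces (hT : Loopless T) (hH : ∀ i, Loopless (H i))
    {X : List (Σ i, List (V i))} (hne : X ≠ []) (hX : AreWalks H X)
    (hc : Cycle.Chain T.Adj (X.map Sigma.fst : Cycle ι)) (hnd : (joinPieces X).Nodup) :
    IsCycle (composition T H) (joinPieces X : Cycle (Σ i, V i)) := by
  obtain ⟨⟨i, l⟩, X, rfl⟩ := List.exists_cons_of_ne_nil hne
  cases l with
  | nil => exact ((hX ⟨i, []⟩ (by simp)).1 rfl).elim
  | cons a l =>
    refine isCycle_of_chain (loopless_composition hT hH) (by simp) hnd ?_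
    rw [joinPieces_cons, List.map_cons, List.cons_append, Cycle.chain_coe_cons]
    rw [List.map_cons, Cycle.chain_coe_cons] at hc
    have := isChain_joinPieces (T := T) (H := H) (X := (⟨i, a :: l⟩ :: X) ++ [⟨i, [a]⟩]) ?_ ?_
    · simpa using this
    · intro c h
      rcases List.mem_append.1 h with h | h
      · exact hX c h
      · obtain rfl := List.mem_singleton.1 h
        simp
    · simpa using hc

/-- A walk of a composition is cut into pieces at the arcs that come from `T`. -/
theorem exists_joinPieces_eq {l : List (Σ i, V i)} (hne : l ≠ [])
    (hc : l.IsChain (composition T H).Adj) {k : ι} (hk : T.Adj (l.getLast hne).1 k) :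
    ∃ c X, joinPieces (c :: X) = l ∧ AreWalks H (c :: X) ∧
      ((c :: X).map Sigma.fst ++ [k]).IsChain T.Adj := by
  induction l with
  | nil => exact (hne rfl).elim
  | cons a l ih =>
    cases l with
    | nil =>
      refine ⟨⟨a.1, [a.2]⟩, [], by simp, by simp [AreWalks], ?_⟩
      simpa using hk
    | cons b l =>
      obtain ⟨hab, hc⟩ := List.isChain_cons_cons.1 hc
      obtain ⟨⟨i, m⟩, X, hj, hw, hch⟩ := ih (by simp) hc (by simpa using hk)
      cases m with
      | nil => exact ((hw ⟨i, []⟩ (by simp)).1 rfl).elim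
      | cons b' m =>
        have hb : b = ⟨i, b'⟩ := by
          simp only [joinPieces_cons, List.map_cons, List.cons_append, List.cons.injEq] at hj
          exact hj.1.symm
        rcases hab with hab | ⟨j, x, y, rfl, hy, hab⟩
        · refine ⟨⟨a.1, [a.2]⟩, ⟨i, b' :: m⟩ :: X, ?_, ?_, ?_⟩
          · rw [joinPieces_cons, hj]; rfl
          · intro c h
            rcases List.mem_cons.1 h with rfl | h
            · simp
            · exact hw c h
          · rw [List.map_cons, List.cons_append, List.map_cons, List.cons_append]
            exact List.isChain_cons_cons.2 ⟨by simpa [hb] using hab, hch⟩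
        · rw [hb] at hy
          obtain ⟨rfl, hy⟩ := Sigma.mk.inj hy
          obtain rfl := eq_of_heq hy
          refine ⟨⟨i, x :: b' :: m⟩, X, ?_, ?_, hch⟩
          · rw [← hj]; rfl
          · intro c h
            rcases List.mem_cons.1 h with rfl | h
            · exact ⟨by simp, List.isChain_cons_cons.2
                ⟨hab, (hw ⟨i, b' :: m⟩ (by simp)).2⟩⟩
            · exact hw c (List.mem_cons_of_mem _ h)

theorem exists_map_sigmaMk_eq {i : ι} {a : V i} {s : List (Σ i, V i)}
    (h : (⟨i, a⟩ :: s).IsChain fun x y : Σ i, V i =>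
      ∃ (j : ι) (b c : V j), x = ⟨j, b⟩ ∧ y = ⟨j, c⟩ ∧ (H j).Adj b c) :
    ∃ s' : List (V i), s = s'.map (Sigma.mk i) ∧ (a :: s').IsChain (H i).Adj := by
  induction s generalizing a with
  | nil => exact ⟨[], rfl, List.isChain_singleton _⟩
  | cons y s ih =>
    obtain ⟨⟨j, b, c, hb, rfl, hbc⟩, hs⟩ := List.isChain_cons_cons.1 h
    obtain ⟨rfl, hb⟩ := Sigma.mk.inj hb
    obtain rfl := eq_of_heq hb
    obtain ⟨s', rfl, hs'⟩ := ih hs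
    exact ⟨c :: s', rfl, List.isChain_cons_cons.2 ⟨hbc, hs'⟩⟩

/-- A cycle of a composition either lies in one of the digraphs `H i`, or is composed of pieces
whose indices form a closed walk of `T`. -/
theorem IsCycle.inner_or_pieces (hH : ∀ i, Loopless (H i)) {l : List (Σ i, V i)}
    (hl : IsCycle (composition T H) (l : Cycle (Σ i, V i))) :
    (∃ (i : ι) (m : List (V i)), IsCycle (H i) (m : Cycle (V i)) ∧ l = m.map (Sigma.mk i)) ∨
    ∃ X : List (Σ i, List (V i)), X ≠ [] ∧ AreWalks H X ∧
      Cycle.Chain T.Adj (X.map Sigma.fst : Cycle ι) ∧ l.Perm (joinPieces X) := by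
  have hnd := Cycle.nodup_coe_iff.1 hl.2.1
  obtain ⟨a, t, rfl⟩ := List.exists_cons_of_ne_nil hl.ne_nil
  obtain ⟨i, a⟩ := a
  have hc := hl.2.2
  rw [Cycle.chain_coe_cons] at hc
  by_cases hR : (⟨i, a⟩ :: (t ++ [⟨i, a⟩])).IsChain fun x y : Σ i, V i =>
      ∃ (j : ι) (b c : V j), x = ⟨j, b⟩ ∧ y = ⟨j, c⟩ ∧ (H j).Adj b c
  · left
    obtain ⟨s, hs, hs'⟩ := exists_map_sigmaMk_eq hR
    obtain ⟨t', r, rfl, rfl, hr⟩ := List.map_eq_append_iff.1 hs.symm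
    obtain ⟨a', rfl, ha'⟩ := List.map_eq_singleton_iff.1 hr
    obtain rfl := sigma_mk_injective ha'
    refine ⟨i, a' :: t', isCycle_of_chain (hH i) (by simp) ?_ ?_, rfl⟩
    · rw [← List.map_cons (f := Sigma.mk i)] at hnd
      exact hnd.of_map _
    · rw [Cycle.chain_coe_cons]; exact hs'
  · right
    -- the cycle is rotated so that its closing arc comes from `T`
    obtain ⟨l', hrot, hne, hT⟩ : ∃ l' : List (Σ i, V i), (⟨i, a⟩ :: t) ~r l' ∧
        ∃ h : l' ≠ [], T.Adj (l'.getLast h).1 (l'.head h).1 := by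
      rw [List.isChain_iff_forall_rel_of_append_cons_cons] at hR
      push Not at hR
      obtain ⟨x, y, l₁, l₂, heq, hxy⟩ := hR
      have hTxy : T.Adj x.1 y.1 :=
        (List.isChain_iff_forall_rel_of_append_cons_cons.1 hc heq).resolve_right
          fun ⟨j, b, c, h1, h2, h3⟩ => hxy j b c h1 h2 h3
      rw [← List.cons_append] at heq
      rcases List.eq_nil_or_concat l₂ with rfl | ⟨l₃, b, rfl⟩
      · rw [show l₁ ++ [x, y] = (l₁ ++ [x]) ++ [y] by simp] at heq
        obtain ⟨h1, h2⟩ := List.append_inj' heq rfl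
        obtain rfl := List.singleton_injective h2
        refine ⟨_, List.IsRotated.refl _, by simp, ?_⟩
        have hlast : (⟨i, a⟩ :: t).getLast (List.cons_ne_nil _ _) = x := by simp [h1]
        rw [hlast]
        exact hTxy
      · rw [List.concat_eq_append, show l₁ ++ x :: y :: (l₃ ++ [b]) =
          ((l₁ ++ [x]) ++ (y :: l₃)) ++ [b] by simp] at heq
        obtain ⟨h1, -⟩ := List.append_inj' heq rfl
        refine ⟨(y :: l₃) ++ (l₁ ++ [x]), ?_, by simp, ?_⟩
        · rw [h1]; exact List.isRotated_append
        · simpa using hTxy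
    have hl' := hl
    rw [Cycle.coe_eq_coe.2 hrot] at hl'
    obtain ⟨c, X, hj, hw, hch⟩ := exists_joinPieces_eq hne hl'.isChain hT
    have hhead : (l'.head hne).1 = c.1 := by
      obtain ⟨j, m⟩ := c
      cases m with
      | nil => exact ((hw ⟨j, []⟩ (by simp)).1 rfl).elim
      | cons b m => simp [← hj]
    refine ⟨c :: X, by simp, hw, ?_, hj ▸ hrot.perm⟩
    rw [hhead] at hch
    rw [List.map_cons, Cycle.chain_coe_cons]
    exact hch

/-- The decomposition of several cycles of a composition: `X` contains the cut cycles that leave the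
digraphs `H i`, and `Y` the cycles that lie in some `H i`. -/
theorem exists_pieces_of_cycles (hH : ∀ i, Loopless (H i)) {K : List (List (Σ i, V i))}
    (hK : ∀ l ∈ K, IsCycle (composition T H) (l : Cycle (Σ i, V i))) :
    ∃ (X : List (List (Σ i, List (V i)))) (Y : List (Σ i, List (V i))),
      K.length = X.length + Y.length ∧
      (∀ Z ∈ X, Z ≠ [] ∧ AreWalks H Z ∧ Cycle.Chain T.Adj (Z.map Sigma.fst : Cycle ι)) ∧
      (∀ c ∈ Y, IsCycle (H c.1) (c.2 : Cycle (V c.1))) ∧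
      K.flatten.Perm (joinPieces (X.flatten ++ Y)) := by
  induction K with
  | nil => exact ⟨[], [], rfl, by simp, by simp, by simp⟩
  | cons l K ih =>
    obtain ⟨X, Y, hlen, hX, hY, hp⟩ := ih fun l hl => hK l (List.mem_cons_of_mem _ hl)
    rcases (hK l (by simp)).inner_or_pieces hH with ⟨i, m, hm, rfl⟩ | ⟨Z, h1, h2, h3, h4⟩
    · refine ⟨X, ⟨i, m⟩ :: Y, by simp [hlen, add_assoc], hX, ?_, ?_⟩
      · intro c h
        rcases List.mem_cons.1 h with rfl | h
        · exact hm
        · exact hY c h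
      · rw [List.flatten_cons]
        refine (hp.append_left _).trans ?_
        simp only [joinPieces_append, joinPieces_cons]
        rw [← List.append_assoc, ← List.append_assoc]
        exact List.perm_append_comm.append_right _
    · refine ⟨Z :: X, Y, by simp [hlen]; omega, ?_, hY, ?_⟩
      · intro W h
        rcases List.mem_cons.1 h with rfl | h
        · exact ⟨h1, h2, h3⟩
        · exact hX W h
      · rw [List.flatten_cons, List.flatten_cons, List.append_assoc, joinPieces_append]
        exact h4.append hp

/-- Contracting each piece to its first vertex turns a family of pieces into a list of vertices. -/
theorem exists_sublist_joinPieces {X : List (Σ i, List (V i))} (hX : ∀ c ∈ X, c.2 ≠ []) :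
    ∃ z : List (Σ i, V i), z.map Sigma.fst = X.map Sigma.fst ∧ z.Sublist (joinPieces X) := by
  induction X with
  | nil => exact ⟨[], rfl, List.Sublist.refl _⟩
  | cons c X ih =>
    obtain ⟨z, h1, h2⟩ := ih fun c h => hX c (List.mem_cons_of_mem _ h)
    obtain ⟨i, m⟩ := c
    cases m with
    | nil => exact (hX ⟨i, []⟩ (by simp) rfl).elim
    | cons a m =>
      refine ⟨⟨i, a⟩ :: z, by simp [h1], ?_⟩
      rw [joinPieces_cons, List.map_cons, List.cons_append]
      exact (h2.trans (List.sublist_append_right _ _)).cons_cons _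

theorem exists_extension_cycles {X : List (List (Σ i, List (V i)))}
    (hX : ∀ Z ∈ X, Z ≠ [] ∧ AreWalks H Z ∧ Cycle.Chain T.Adj (Z.map Sigma.fst : Cycle ι)) :
    ∃ E : List (List (Σ i, V i)),
      (∀ z ∈ E, z ≠ [] ∧ Cycle.Chain (extension V T).Adj (z : Cycle (Σ i, V i))) ∧
      E.flatten.map Sigma.fst = X.flatten.map Sigma.fst ∧
      E.flatten.Sublist (joinPieces X.flatten) := by
  induction X with
  | nil => exact ⟨[], by simp, rfl, List.Sublist.refl _⟩
  | cons Z X ih =>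
    obtain ⟨E, h1, h2, h3⟩ := ih fun Z h => hX Z (List.mem_cons_of_mem _ h)
    obtain ⟨hne, hw, hc⟩ := hX Z (by simp)
    obtain ⟨z, hz1, hz2⟩ := exists_sublist_joinPieces fun c h => (hw c h).1
    refine ⟨z :: E, ?_, by simp [hz1, h2], ?_⟩
    · intro w h
      rcases List.mem_cons.1 h with rfl | h
      · refine ⟨fun hw => hne ?_, ?_⟩
        · rw [hw] at hz1
          exact List.map_eq_nil_iff.1 hz1.symm
        · rw [← hz1, ← Cycle.map_coe, Cycle.chain_map] at hc
          exact hc.imp fun a b h => extension_adj.2 h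
      · exact h1 w h
    · rw [List.flatten_cons, List.flatten_cons, joinPieces_append]
      exact hz2.append h3

end Pieces

/-! ### The largest number of covered vertices of a class -/

theorem exists_isPartialArcPerm_of_cycles {ι α : Type*} {T : Digraph ι} {cl : α → ι}
    (hT : Loopless T) {K : List (List α)} (hnd : K.flatten.Nodup)
    (hK : ∀ l ∈ K, Cycle.Chain (fun a b => T.Adj (cl a) (cl b)) (l : Cycle α)) :
    ∃ g : Equiv.Perm α, IsPartialArcPerm T cl g ∧ ∀ x, g x ≠ x ↔ x ∈ K.flatten := by
  classical
  induction K with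
  | nil => exact ⟨1, fun v => Or.inl rfl, by simp⟩
  | cons l K ih =>
    rw [List.flatten_cons, List.nodup_append'] at hnd
    obtain ⟨hl, hnd, hdisj⟩ := hnd
    obtain ⟨g, hg, hmem⟩ := ih hnd fun l hl => hK l (List.mem_cons_of_mem _ hl)
    have h1 : ∀ x ∈ l, T.Adj (cl x) (cl ((l.formPerm * g) x)) := by
      intro x hx
      have hgx : g x = x := by
        by_contra h
        exact hdisj hx ((hmem x).1 h)
      rw [Equiv.Perm.mul_apply, hgx]
      exact rel_formPerm_of_chain hl (hK l (by simp)) hx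
    have h2 : ∀ x, x ∉ l → (l.formPerm * g) x = g x := by
      intro x hx
      rw [Equiv.Perm.mul_apply]
      refine List.formPerm_apply_of_notMem fun hgx => ?_
      by_cases h : g x = x
      · exact hx (h ▸ hgx)
      · exact hdisj hgx ((hmem _).1 fun h' => h (g.injective h'))
    refine ⟨l.formPerm * g, fun x => ?_, fun x => ?_⟩
    · by_cases hx : x ∈ l
      · exact Or.inr (h1 x hx)
      · rw [h2 x hx]; exact hg x
    · rw [List.flatten_cons, List.mem_append]
      by_cases hx : x ∈ l
      · simp only [hx, true_or, iff_true]
        intro h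
        have := h1 x hx
        rw [h] at this
        exact hT _ this
      · simp [h2 x hx, hmem, hx]

theorem ncard_mem_class_eq_count {ι α : Type*} [DecidableEq ι] (cl : α → ι) {l : List α}
    (hl : l.Nodup) (i : ι) : {x | cl x = i ∧ x ∈ l}.ncard = (l.map cl).count i := by
  classical
  have : {x | cl x = i ∧ x ∈ l} = ((l.filter fun x => cl x = i).toFinset : Set α) := by
    ext x; simp [and_comm]
  rw [this, Set.ncard_coe_finset, List.toFinset_card_of_nodup (hl.filter _), List.count,
    List.countP_map, List.countP_eq_length_filter]
  congr 1

section Factors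

variable {ι : Type u} [Fintype ι] {V : ι → Type v} [∀ i, Fintype (V i)]
  {T : Digraph ι} {H : ∀ i, Digraph (V i)}

theorem count_le_maxCover [DecidableEq ι] (hT : Loopless T) {E : List (List (Σ i, V i))}
    (hE : ∀ z ∈ E, z ≠ [] ∧ Cycle.Chain (extension V T).Adj (z : Cycle (Σ i, V i)))
    (hnd : E.flatten.Nodup) (i : ι) : (E.flatten.map Sigma.fst).count i ≤ maxCover V T i := by
  have h : IsPathCycleList (extension V T) [] E :=
    ⟨by simp, fun z hz => isCycle_of_chain (loopless_extension hT) (hE z hz).1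
      ((List.nodup_flatten.1 hnd).1 z hz) (hE z hz).2, by simpa using hnd⟩
  obtain ⟨S, hS⟩ := h.exists_pathCycleSubdigraph
  refine (isGreatest_maxCover V T i).2 ⟨_, S, ?_⟩
  rw [← ncard_mem_class_eq_count _ hnd, hS]
  congr 1
  ext x
  simp [and_comm]

/-- A single cycle of the extension covers `m_i` vertices of each class `i`. -/
theorem exists_cycle_count_eq_maxCover [DecidableEq ι] [Nontrivial ι] [∀ i, Nonempty (V i)]
    (hT : Loopless T) (hsemi : Semicomplete T) (hstrong : Strong T) :
    ∃ cs : List ι, Cycle.Chain T.Adj (cs : Cycle ι) ∧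
      ∀ i, 0 < cs.count i ∧ cs.count i = maxCover V T i ∧ cs.count i ≤ Fintype.card (V i) := by
  have hcl : Function.Surjective (Sigma.fst : (Σ i, V i) → ι) := fun i =>
    ⟨⟨i, Classical.arbitrary _⟩, rfl⟩
  obtain ⟨l, hnd, hex, hc, hmax⟩ := exists_cyclic_list_ncard_le hT hsemi hstrong hcl
  refine ⟨l.map Sigma.fst, by rwa [← Cycle.map_coe, Cycle.chain_map], fun i => ⟨?_, ?_, ?_⟩⟩
  · obtain ⟨v, hv, hi⟩ := hex i
    exact List.count_pos_iff.2 (List.mem_map.2 ⟨v, hv, hi⟩)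
  · refine le_antisymm ?_ ?_
    · have hne : l ≠ [] := by
        obtain ⟨v, hv, -⟩ := hex i
        exact List.ne_nil_of_mem hv
      have := count_le_maxCover (E := [l]) hT
        (by simpa using ⟨hne, hc.imp fun a b h => extension_adj.2 h⟩) (by simpa using hnd) i
      simpa using this
    · obtain ⟨t, S, hS⟩ := (isGreatest_maxCover V T i).1
      obtain ⟨L, K, hL, -, h, hv⟩ := S.exists_isPathCycleList
      obtain rfl := List.length_eq_zero_iff.1 hL
      obtain ⟨g, hg, hmem⟩ := exists_isPartialArcPerm_of_cycles (cl := Sigma.fst) (K := K) hT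
        (by simpa using h.nodup)
        fun l hl => (h.isCycle l hl).2.2.imp fun a b h => extension_adj.1 h
      rw [← hS, ← ncard_mem_class_eq_count _ hnd]
      refine le_trans (le_of_eq ?_) (hmax g hg i)
      congr 1
      ext x
      rw [hv]
      simp [hmem, and_comm]
  · rw [← ncard_mem_class_eq_count _ hnd, ← Nat.card_eq_fintype_card]
    refine (Set.ncard_le_ncard (t := Set.range (Sigma.mk i)) ?_ (Set.toFinite _)).trans ?_
    · rintro ⟨j, x⟩ ⟨h, -⟩
      obtain rfl : j = i := h
      exact ⟨x, rfl⟩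
    · rw [← Set.image_univ]
      exact (Set.ncard_image_le (Set.toFinite _)).trans (Set.ncard_univ _).le

end Factors

/-! ### Cycle factors of a composition -/

/-- Replacing the vertices of a closed walk of `T` by the paths of path-cycle factors of the
digraphs `H i` yields a cycle factor of the composition with one additional cycle. -/
theorem hasCycleFactor_of_pathCycleFactors {ι : Type u} [Fintype ι] [DecidableEq ι]
    {V : ι → Type v} {T : Digraph ι} {H : ∀ i, Digraph (V i)} (hT : Loopless T)
    (hH : ∀ i, Loopless (H i)) {cs : List ι} (hcs : Cycle.Chain T.Adj (cs : Cycle ι))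
    (hne : cs ≠ []) {j : ι → ℕ} (h : ∀ i, HasPathCycleFactor (H i) (cs.count i) (j i)) :
    HasCycleFactor (composition T H) (1 + ∑ i, j i) := by
  choose L K hL hK hLK hall using fun i => hasPathCycleFactor_iff.1 (h i)
  obtain ⟨X, hXcs, hX⟩ := exists_piecesIn_eq cs L hL
  obtain ⟨Y, hYlen, hY⟩ := exists_piecesIn_eq_of_fintype K
  have hXY : ∀ i, piecesIn i (X ++ Y) = L i ++ K i := fun i => by rw [piecesIn_append, hX, hY]
  have hnd : (joinPieces (X ++ Y)).Nodup := nodup_joinPieces.2 fun i => by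
    rw [hXY]; exact (hLK i).nodup
  have hflat : (joinPieces X :: Y.map fun c => c.2.map (Sigma.mk c.1)).flatten =
      joinPieces (X ++ Y) := by
    rw [List.flatten_cons, joinPieces_append]
    rfl
  refine hasPathCycleFactor_iff.2
    ⟨[], joinPieces X :: Y.map fun c => c.2.map (Sigma.mk c.1), rfl, ?_, ⟨by simp, ?_, ?_⟩, ?_⟩
  · simp [hYlen, hK, add_comm]
  · intro l hl
    rcases List.mem_cons.1 hl with rfl | hl
    · refine isCycle_joinPieces hT hH ?_ ?_ (hXcs ▸ hcs) ?_
      · rintro rfl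
        exact hne hXcs.symm
      · rintro ⟨i, m⟩ hc
        rw [← mem_piecesIn, hX] at hc
        exact ⟨((hLK i).isPath m hc).1, ((hLK i).isPath m hc).2.2⟩
      · rw [joinPieces_append] at hnd
        exact hnd.of_append_left
    · obtain ⟨⟨i, m⟩, hc, rfl⟩ := List.mem_map.1 hl
      rw [← mem_piecesIn, hY] at hc
      have hm := (hLK i).isCycle m hc
      refine isCycle_of_chain (loopless_composition hT hH) ?_ ?_ ?_
      · simpa using hm.ne_nil
      · exact (Cycle.nodup_coe_iff.1 hm.2.1).map sigma_mk_injective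
      · rw [← Cycle.map_coe, Cycle.chain_map]
        exact hm.2.2.imp fun a b hab => Or.inr ⟨i, a, b, rfl, rfl, hab⟩
  · rw [List.nil_append, hflat]
    exact hnd
  · rintro ⟨i, x⟩
    rw [List.nil_append, hflat, mem_joinPieces, hXY]
    exact hall i x

/-- A cycle factor of the composition induces a path-cycle factor of each `H i`. The `c` cycles that
leave the digraphs `H i` contract to a cycle subdigraph of the extension, which bounds the numbers
of paths. -/
theorem HasCycleFactor.exists_pathCycleFactors {ι : Type u} [Fintype ι] {V : ι → Type v}
    [∀ i, Fintype (V i)] {T : Digraph ι} {H : ∀ i, Digraph (V i)} (hT : Loopless T)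
    (hH : ∀ i, Loopless (H i))
    {k : ℕ} (h : HasCycleFactor (composition T H) k) :
    ∃ (c : ℕ) (p j : ι → ℕ), k = c + ∑ i, j i ∧ (c = 0 → ∀ i, p i = 0) ∧
      ∀ i, p i ≤ maxCover V T i ∧ HasPathCycleFactor (H i) (p i) (j i) := by
  classical
  obtain ⟨L, K, hL, rfl, hLK, hall⟩ := hasPathCycleFactor_iff.1 h
  obtain rfl := List.length_eq_zero_iff.1 hL
  obtain ⟨X, Y, hlen, hX, hY, hperm⟩ := exists_pieces_of_cycles hH hLK.isCycle
  have hnd : (joinPieces (X.flatten ++ Y)).Nodup := hperm.nodup_iff.1 (by simpa using hLK.nodup)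
  have hnd' : ∀ i, (piecesIn i X.flatten ++ piecesIn i Y).flatten.Nodup := fun i => by
    rw [← piecesIn_append]
    exact nodup_joinPieces.1 hnd i
  refine ⟨X.length, fun i => (piecesIn i X.flatten).length, fun i => (piecesIn i Y).length,
    ?_, ?_, fun i => ⟨?_, ?_⟩⟩
  · rw [hlen, length_eq_sum_length_piecesIn]
  · intro h0 i
    rw [List.length_eq_zero_iff.1 h0]
    rfl
  · obtain ⟨E, h1, h2, h3⟩ := exists_extension_cycles hX
    change (piecesIn i X.flatten).length ≤ _
    rw [length_piecesIn, ← h2]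
    rw [joinPieces_append] at hnd
    exact count_le_maxCover hT h1 (h3.nodup hnd.of_append_left) i
  · refine hasPathCycleFactor_iff.2 ⟨_, _, rfl, rfl, ⟨?_, ?_, hnd' i⟩, fun x => ?_⟩
    · intro l hl
      have hmem := mem_piecesIn.1 hl
      obtain ⟨Z, hZ, hlZ⟩ := List.mem_flatten.1 hmem
      obtain ⟨hne, hch⟩ := (hX Z hZ).2.1 _ hlZ
      exact ⟨hne, (List.nodup_flatten.1 (hnd' i)).1 l (List.mem_append_left _ hl), hch⟩
    · exact fun l hl => hY _ (mem_piecesIn.1 hl)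
    · rw [← piecesIn_append, ← mem_joinPieces, ← hperm.mem_iff]
      simpa using hall ⟨i, x⟩

end DigraphComp

theorem mainTheorem1 {ι : Type*} [Fintype ι] (hι : 2 ≤ Fintype.card ι)
    {V : ι → Type*} [∀ i, Fintype (V i)] [∀ i, Nonempty (V i)]
    (T : Digraph ι) (H : ∀ i, Digraph (V i))
    (hT : DigraphComp.Loopless T) (hH : ∀ i, DigraphComp.Loopless (H i))
    (hsemi : DigraphComp.Semicomplete T)
    (hstrong : DigraphComp.Strong (DigraphComp.composition T H))
    (hfactor : ∃ k, DigraphComp.HasCycleFactor (DigraphComp.composition T H) k) :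
    (∀ i ∈ DigraphComp.deficient T H,
      {j : ℕ | DigraphComp.eta (H i) j = (DigraphComp.maxCover V T i : ℕ∞)}.Nonempty) ∧
    IsLeast {k : ℕ | DigraphComp.HasCycleFactor (DigraphComp.composition T H) k}
      (1 + ∑ i ∈ DigraphComp.deficient T H,
        sInf {j : ℕ | DigraphComp.eta (H i) j = (DigraphComp.maxCover V T i : ℕ∞)}) := by
  classical
  have : Nontrivial ι := Fintype.one_lt_card_iff_nontrivial.1 hι
  obtain ⟨cs, hcs, hcount⟩ := DigraphComp.exists_cycle_count_eq_maxCover (V := V) hT hsemi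
    hstrong.of_composition
  obtain ⟨k₀, hk₀⟩ := hfactor
  obtain ⟨-, p₀, j₀, -, -, hpj₀⟩ := hk₀.exists_pathCycleFactors hT hH
  have hdef : ∀ i, i ∈ DigraphComp.deficient T H ↔
      DigraphComp.maxCover V T i < DigraphComp.pc (H i) := fun i => by
    simp [DigraphComp.deficient]
  have heta := fun i hi => DigraphComp.exists_eta_eq ((hdef i).1 hi) (hpj₀ i).1 (hpj₀ i).2
  refine ⟨fun i hi => (heta i hi).1, ?_, ?_⟩
  · have hne : cs ≠ [] := by
      obtain ⟨i⟩ := (inferInstance : Nonempty ι)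
      exact List.ne_nil_of_mem (List.count_pos_iff.1 (hcount i).1)
    rw [← Finset.univ_inter (DigraphComp.deficient T H), ← Finset.sum_ite_mem]
    refine DigraphComp.hasCycleFactor_of_pathCycleFactors hT hH hcs hne fun i => ?_
    rw [(hcount i).2.1]
    split_ifs with hi
    · exact (heta i hi).2.1
    · rw [hdef, not_lt] at hi
      exact DigraphComp.hasPathCycleFactor_of_pc_le hi ((hcount i).2.1 ▸ (hcount i).2.2)
  · intro k hk
    obtain ⟨c, p, j, rfl, hc, hpj⟩ := DigraphComp.HasCycleFactor.exists_pathCycleFactors hT hH hk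
    rcases Nat.eq_zero_or_pos c with rfl | hcpos
    · -- without such cycles each `H i` has a cycle factor; opening one cycle gives one path
      have hj : ∀ i, ∃ j', j i = j' + 1 := fun i => by
        refine Nat.exists_eq_succ_of_ne_zero fun h0 => ?_
        have h1 := (hpj i).2
        rw [hc rfl i, h0] at h1
        obtain ⟨L, K, hL, hK, -, hall⟩ := DigraphComp.hasPathCycleFactor_iff.1 h1
        obtain rfl := List.length_eq_zero_iff.1 hL
        obtain rfl := List.length_eq_zero_iff.1 hK
        simpa using hall (Classical.arbitrary (V i))
      choose j' hj' using hj
      have hle : ∑ i ∈ DigraphComp.deficient T H,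
          sInf {j : ℕ | DigraphComp.eta (H i) j = (DigraphComp.maxCover V T i : ℕ∞)} ≤
          ∑ i, j' i := by
        refine (Finset.sum_le_sum fun i hi => ?_).trans
          (Finset.sum_le_sum_of_subset (Finset.subset_univ _))
        refine (heta i hi).2.2 _ ⟨1, ?_, ?_⟩
        · rw [← (hcount i).2.1]
          exact (hcount i).1
        · have h1 := (hpj i).2
          rw [hc rfl i, hj'] at h1
          exact h1.open_cycle
      simp only [hj', Finset.sum_add_distrib, Finset.sum_const, Finset.card_univ, smul_eq_mul]
      omega
    · refine Nat.add_le_add hcpos ((Finset.sum_le_sum fun i hi => ?_).trans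
        (Finset.sum_le_sum_of_subset (Finset.subset_univ _)))
      exact (heta i hi).2.2 _ ⟨_, (hpj i).1, (hpj i).2⟩
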